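/- Let $N\ge 1$ be an integer and $s\in(0,1)$, $\alpha\in(0,N)$, $\theta\in(0,\alpha)$ with $2s<N<2s+\alpha$. Let $V:\mathbb R^N\to\mathbb R$ be continuous with $$0<V_0:=\min_{\mathbb R^N}V<\liminf_{|x|\to\infty}V(x)\in(V_0,+\infty],\qquad M:=\{x\in\mathbb R^N: V(x)=V_0\}.$$ Let $f:\mathbb R\to\mathbb R$ be of class $C^1$ with $f(t)=0$ for $t\le 0$, $\lim_{t\to0}f(t)/t=0$, $\lim_{t\to\infty}f(t)/t^{q_0}=0$ for some $q_0\in(2,\frac{2N}{N-2s}-1)$, $0<KF(t)\le tf(t)$ for all $t>0$ and some $K>4$, where $F(t)=\int_0^tf$, and $t\mapsto f(t)/t^3$ strictly increasing on $(0,\infty)$. All functions are real valued. Let $H^s(\mathbb R^N)=\{u\in L^2:(-\Delta)^{s/2}u\in L^2\}$, with norm $\|u\|^2=|(-\Delta)^{s/2}u|_2^2+|u|_2^2$. For $\varepsilon>0$ and $u\in H^s(\mathbb R^N)$ let $\phi_{\varepsilon,u}\in\dot H^{\alpha/2}(\mathbb R^N)$ be the unique weak solution of $$(-\Delta)^{\alpha/2}\phi=\varepsilon^{\alpha-\theta}\gamma_\alpha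 u^2,\qquad \gamma_\alpha=\frac{\pi^{N/2}2^\alpha\Gamma(\alpha/2)}{\Gamma(N/2-\alpha/2)},$$ where $\dot H^{\alpha/2}(\mathbb R^N)$ is the completion of $C_c^\infty(\mathbb R^N)$ with respect to $|(-\Delta)^{\alpha/4}\cdot|_2$. Let $W_\varepsilon=\{u\in H^s(\mathbb R^N):\int V(\varepsilon x)u^2<\infty\}$, $\|u\|_\varepsilon^2=\int|(-\Delta)^{s/2}u|^2+\int V(\varepsilon x)u^2$, $$I_\varepsilon(u)=\tfrac12\|u\|_\varepsilon^2+\tfrac14\int\phi_{\varepsilon,u}u^2-\int F(u),$$ $$\mathcal N_\varepsilon=\Big\{u\in W_\varepsilon\setminus\{0\}:\ \|u\|_\varepsilon^2+\int\phi_{\varepsilon,u}u^2=\int f(u)u\Big\}.$$ Finally let $$E_{V_0}(u)=\tfrac12\int|(-\Delta)^{s/2}u|^2+\tfrac{V_0}2\int u^2-\int F(u),\qquad m^\infty_{V_0}=\inf_{u\in\mathcal M_{V_0}}E_{V_0}(u),$$ $$\mathcal M_{V_0}=\Big\{u\in H^s(\mathbb R^N)\setminus\{0\}:\ \int|(-\Delta)^{s/2}u|^2+V_0\int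 u^2=\int f(u)u\Big\}.$$ **Proposition.** Let $\varepsilon_n\to0^+$ and $u_n\in\mathcal N_{\varepsilon_n}$ be such that $I_{\varepsilon_n}(u_n)\to m^\infty_{V_0}$. Then there exists a sequence $\{\tilde y_n\}\subset\mathbb R^N$ such that $u_n(\cdot+\tilde y_n)$ has a subsequence converging in $H^s(\mathbb R^N)$. Moreover, up to passing to a further subsequence, $\varepsilon_n\tilde y_n\to y$ for some $y\in M$. -/

import Mathlib

open Filter Topology MeasureTheory FourierTransform
open scoped ENNReal ContDiff

noncomputable section

namespace FracSP

/-- Euclidean space `ℝ^N`. Functions on it are identified when they agree almost everywhere. -/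
abbrev Space (N : ℕ) : Type := EuclideanSpace ℝ (Fin N)

open Classical in
/-- The Fourier transform (on `L²`) of a real square integrable function. -/
def fourierL2 {N : ℕ} (u : Space N → ℝ) : Space N → ℂ :=
  if h : MemLp (fun x => (u x : ℂ)) 2 volume then
    ((𝓕 (h.toLp (fun x => (u x : ℂ))) : Lp ℂ 2 (volume : Measure (Space N))) : Space N → ℂ)
  else 0

/-- `|·|^{2β} 𝓕 u`. In Mathlib's normalization `exp (-2πi x·ξ)` of the Fourier transform the symbol
of `(-Δ)^β` is `(2π|ξ|)^{2β}`. -/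
def fracMultiplier {N : ℕ} (β : ℝ) (u : Space N → ℝ) : Space N → ℂ :=
  fun ξ => (((2 * Real.pi * ‖ξ‖) ^ (2 * β) : ℝ) : ℂ) * fourierL2 u ξ

open Classical in
/-- The fractional Laplacian `(-Δ)^β u ∈ L²`, given by `𝓕 ((-Δ)^β u) = |·|^{2β} 𝓕 u`
(zero when the right-hand side is not in `L²`). Since `u` is real and the symbol is real and even,
it is a.e. real valued. -/
def fracLap {N : ℕ} (β : ℝ) (u : Space N → ℝ) : Lp ℂ 2 (volume : Measure (Space N)) :=
  if h : MemLp (fracMultiplier β u) 2 volume then 𝓕⁻ (h.toLp (fracMultiplier β u)) else 0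

/-- `u ∈ H^s(ℝ^N)`: both `u` and `(-Δ)^{s/2} u` are in `L²`. -/
def MemHs {N : ℕ} (s : ℝ) (u : Space N → ℝ) : Prop :=
  MemLp u 2 volume ∧ MemLp (fracMultiplier (s / 2) u) 2 volume

/-- The norm `(|(-Δ)^{s/2} u|₂² + |u|₂²)^{1/2}` of `H^s(ℝ^N)`. -/
def hsNorm {N : ℕ} (s : ℝ) (u : Space N → ℝ) : ℝ :=
  Real.sqrt (‖fracLap (s / 2) u‖ ^ 2 + ∫ x, u x ^ 2)

/-- Convergence `w k → v` in `H^s(ℝ^N)`. -/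
def TendstoHs {N : ℕ} (s : ℝ) (w : ℕ → Space N → ℝ) (v : Space N → ℝ) : Prop :=
  (∀ k, MemHs s (w k)) ∧ MemHs s v ∧ Tendsto (fun k => hsNorm s (w k - v)) atTop (𝓝 0)

/-- `v ∈ Ḣ^{α/2}(ℝ^N)` with `(-Δ)^{α/4} v = g`. The space is the completion of `C_c^∞` for the norm
`|(-Δ)^{α/4} v|₂`, realized inside `L^{2N/(N-α)}` by the Sobolev embedding. -/
def HasDotFracLap {N : ℕ} (α : ℝ) (v : Space N → ℝ)
    (g : Lp ℂ 2 (volume : Measure (Space N))) : Prop :=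
  MemLp v (ENNReal.ofReal (2 * N / (N - α))) volume ∧
  ∃ ψ : ℕ → Space N → ℝ,
    (∀ k, ContDiff ℝ ∞ (ψ k) ∧ HasCompactSupport (ψ k)) ∧
    Tendsto (fun k => eLpNorm (ψ k - v) (ENNReal.ofReal (2 * N / (N - α))) volume) atTop (𝓝 0) ∧
    Tendsto (fun k => fracLap (α / 4) (ψ k)) atTop (𝓝 g)

/-- The constant `γ_α = π^{N/2} 2^α Γ(α/2) / Γ(N/2 - α/2)`. -/
def gammaConst (N : ℕ) (α : ℝ) : ℝ :=
  Real.pi ^ ((N : ℝ) / 2) * 2 ^ α * Real.Gamma (α / 2) / Real.Gamma ((N : ℝ) / 2 - α / 2)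

/-- `φ ∈ Ḣ^{α/2}` is a weak solution of `(-Δ)^{α/2} φ = ε^{α-θ} γ_α u²`:
`∫ (-Δ)^{α/4} φ (-Δ)^{α/4} v = ε^{α-θ} γ_α ∫ u² v` for all `v ∈ Ḣ^{α/2}`. -/
def IsPoissonSolution {N : ℕ} (α θ ε : ℝ) (u φ : Space N → ℝ) : Prop :=
  ∃ g, HasDotFracLap α φ g ∧ ∀ v h, HasDotFracLap α v h →
    inner ℂ g h = ((ε ^ (α - θ) * gammaConst N α * ∫ x, u x ^ 2 * v x : ℝ) : ℂ)

open Classical in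
/-- `φ_{ε,u}`, the (unique up to null sets) weak solution in `Ḣ^{α/2}` of
`(-Δ)^{α/2} φ = ε^{α-θ} γ_α u²`. -/
def poisson {N : ℕ} (α θ ε : ℝ) (u : Space N → ℝ) : Space N → ℝ :=
  if h : ∃ φ, IsPoissonSolution α θ ε u φ then h.choose else 0

/-- The primitive `F(t) = ∫₀ᵗ f`. -/
def primitive (f : ℝ → ℝ) (t : ℝ) : ℝ := ∫ τ in (0 : ℝ)..t, f τ

/-- `u ∈ W_ε`. -/
def MemW {N : ℕ} (s : ℝ) (V : Space N → ℝ) (ε : ℝ) (u : Space N → ℝ) : Prop :=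
  MemHs s u ∧ Integrable (fun x => V (ε • x) * u x ^ 2) volume

/-- `‖u‖_ε² = ∫ |(-Δ)^{s/2} u|² + ∫ V(εx) u²`. -/
def normWSq {N : ℕ} (s : ℝ) (V : Space N → ℝ) (ε : ℝ) (u : Space N → ℝ) : ℝ :=
  ‖fracLap (s / 2) u‖ ^ 2 + ∫ x, V (ε • x) * u x ^ 2

/-- The functional `I_ε`. -/
def energyI {N : ℕ} (s α θ : ℝ) (V : Space N → ℝ) (f : ℝ → ℝ) (ε : ℝ)
    (u : Space N → ℝ) : ℝ :=
  1 / 2 * ‖fracLap (s / 2) u‖ ^ 2 + 1 / 2 * (∫ x, V (ε • x) * u x ^ 2)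
    + 1 / 4 * (∫ x, poisson α θ ε u x * u x ^ 2) - ∫ x, primitive f (u x)

/-- `J_ε(u) = I_ε'(u)[u] = ‖u‖_ε² + ∫ φ_{ε,u} u² - ∫ f(u) u`. -/
def nehariJ {N : ℕ} (s α θ : ℝ) (V : Space N → ℝ) (f : ℝ → ℝ) (ε : ℝ)
    (u : Space N → ℝ) : ℝ :=
  normWSq s V ε u + (∫ x, poisson α θ ε u x * u x ^ 2) - ∫ x, f (u x) * u x

/-- The Nehari manifold `𝓝_ε = {u ∈ W_ε \ {0} : J_ε(u) = 0}`. -/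
def nehariN {N : ℕ} (s α θ : ℝ) (V : Space N → ℝ) (f : ℝ → ℝ) (ε : ℝ) :
    Set (Space N → ℝ) :=
  {u | MemW s V ε u ∧ ¬ u =ᵐ[volume] 0 ∧ nehariJ s α θ V f ε u = 0}

/-- The functional `E_μ` of the limit problem. -/
def energyE {N : ℕ} (s : ℝ) (f : ℝ → ℝ) (μ : ℝ) (u : Space N → ℝ) : ℝ :=
  1 / 2 * ‖fracLap (s / 2) u‖ ^ 2 + μ / 2 * (∫ x, u x ^ 2) - ∫ x, primitive f (u x)

/-- The Nehari manifold `𝓜_μ` of the limit problem. -/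
def nehariM (N : ℕ) (s : ℝ) (f : ℝ → ℝ) (μ : ℝ) : Set (Space N → ℝ) :=
  {u | MemHs s u ∧ ¬ u =ᵐ[volume] 0 ∧
    ‖fracLap (s / 2) u‖ ^ 2 + μ * (∫ x, u x ^ 2) = ∫ x, f (u x) * u x}

/-- The ground state level `m^∞_μ = inf_{𝓜_μ} E_μ`. -/
def groundLevel (N : ℕ) (s : ℝ) (f : ℝ → ℝ) (μ : ℝ) : ℝ :=
  sInf (energyE s f μ '' nehariM N s f μ)

end FracSP

end

/-! Write `H(t) = f(t)t/4 - F(t)` and `Φ(u) = ‖u‖²/4 + ∫ H(u)`, with the `H^s` norm of constant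
potential `V₀`. The Ambrosetti–Rabinowitz condition gives `H ≥ 0`, and monotonicity of `f(t)/t³`
makes `H` nondecreasing along rays.

Energy squeeze. On `𝓝_ε`, subtracting a quarter of the constraint from `I_ε` removes the Poisson
term and leaves `I_ε(u) = Φ(u) + (1/4)∫ (V(εx) - V₀)u²`. Since the Poisson term is nonnegative,
`‖u‖² ≤ ∫ f(u)u`. For every nonzero `u` with this inequality some `tu` with `t ∈ (0, 1]` lies on
`𝓜_{V₀}`, and `Φ(tu) ≤ Φ(u)`, so `Φ(u) ≥ m^∞` (`groundLevel_le`). Hence `m^∞ ≤ Φ(u_n) ≤ I_{ε_n}(u_n)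
→ m^∞`: both `Φ(u_n) → m^∞` and `∫ (V(ε_n x) - V₀)u_n² → 0`.

Compactness (`exists_shift_tendsto`). No Palais–Smale sequence is needed. The constraint inequality
keeps the `L^p` norm away from zero, so suitable translates have a weak limit `v ≠ 0`. By
Brezis–Lieb, `Φ` and the constraint split between `v` and the remainder. If `v` satisfies the
inequality, then `Φ(v) ≥ m^∞` leaves nothing for the remainder, which tends to zero in norm.
Otherwise the remainder satisfies it, costs at least `m^∞` by itself, and contradicts `Φ(v) > 0`.

Concentration (`exists_tendsto_minimum`). The translates keep mass in a fixed ball, so the vanishing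
potential term forces `V` to be close to `V₀` near `ε_n y_n`.

The analysis of `H^s` is done on the Fourier side: `u` is encoded by an `L²` function `a` with `‖a‖
= ‖u‖`, translations become characters, and the value at `x` of a band limited part is an inner
product with a fixed vector (`fmul_band_ae`). That formula yields the Sobolev inequality,
nonvanishing and local compactness. -/

noncomputable section

/-! ### The Fourier transform on `L²` and multiplication operators -/

namespace FracSP

/-- Complex square integrable functions. -/
abbrev L2 (N : ℕ) : Type := Lp ℂ 2 (volume : Measure (Space N))

variable {N : ℕ}

/-- On tempered distributions the inverse transform is defined by duality. Pairing with Schwartz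
functions is how pointwise information about the abstract `L²` transform is obtained. -/
theorem integral_schwartz_smul_fourierInv (a : L2 N) (φ : SchwartzMap (Space N) ℂ) :
    ∫ x, φ x • (𝓕⁻ a : L2 N) x = ∫ ξ, (𝓕⁻ φ) ξ • a ξ := by
  rw [← Lp.toTemperedDistribution_apply, ← Lp.fourierInv_toTemperedDistribution_eq,
    TemperedDistribution.fourierInv_apply, Lp.toTemperedDistribution_apply]

theorem ae_eq_of_integral_schwartz {u v : Space N → ℂ} (hu : LocallyIntegrable u)
    (hv : LocallyIntegrable v)
    (h : ∀ φ : SchwartzMap (Space N) ℂ, HasCompactSupport φ → ∫ x, φ x • u x = ∫ x, φ x • v x) :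
    u =ᵐ[volume] v := by
  refine ae_eq_of_integral_contDiff_smul_eq hu hv fun g hg hgs => ?_
  have h1 : HasCompactSupport (fun x => (g x : ℂ)) := hgs.comp_left Complex.ofReal_zero
  have h2 : ContDiff ℝ ∞ (fun x => (g x : ℂ)) := Complex.ofRealCLM.contDiff.comp hg
  have := h (h1.toSchwartzMap h2) h1
  simpa using this

theorem locallyIntegrable_coe (a : L2 N) : LocallyIntegrable (a : Space N → ℂ) :=
  (Lp.memLp a).locallyIntegrable (by norm_num)

/-- By Fubini the inverse Fourier integral has the same pairings with Schwartz functions as the `L²`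
transform. -/
theorem fourierInv_ae_eq (a : L2 N) (ha : Integrable (a : Space N → ℂ)) :
    ((𝓕⁻ a : L2 N) : Space N → ℂ) =ᵐ[volume] 𝓕⁻ (a : Space N → ℂ) := by
  have hc : Continuous (𝓕⁻ (a : Space N → ℂ)) := by
    have := (Real.Lp.fourierTransformInv (ha.toL1 a)).continuous
    rw [Real.Lp.coe_fourierTransformInv] at this
    rwa [funext fun x => Real.fourierInv_congr_ae ha.coeFn_toL1 x] at this
  refine ae_eq_of_integral_schwartz (locallyIntegrable_coe _) hc.locallyIntegrable fun φ _ => ?_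
  rw [integral_schwartz_smul_fourierInv, SchwartzMap.fourierInv_coe]
  have := VectorFourier.integral_fourierIntegral_smul_eq_flip (L := -innerₗ (Space N))
    Real.continuous_fourierChar (by simp only [LinearMap.neg_apply, innerₗ_apply_apply]; fun_prop)
    (φ.integrable (μ := volume)) ha
  rw [show (-innerₗ (Space N)).flip = -innerₗ (Space N) by
    ext x y; simp [real_inner_comm]] at this
  exact this

theorem fourierInv_translate (y : Space N) (a b : L2 N)
    (hb : (b : Space N → ℂ) =ᵐ[volume]
      fun ξ => Complex.exp (2 * Real.pi * (inner ℝ ξ y : ℝ) * Complex.I) * a ξ) :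
    ((𝓕⁻ b : L2 N) : Space N → ℂ) =ᵐ[volume] fun x => (𝓕⁻ a : L2 N) (x + y) := by
  refine ae_eq_of_integral_schwartz (locallyIntegrable_coe _) ?_ fun φ hφ => ?_
  · have : MemLp (fun x => (𝓕⁻ a : L2 N) (x + y)) 2 volume :=
      (Lp.memLp (𝓕⁻ a : L2 N)).comp_measurePreserving (measurePreserving_add_right volume y)
    exact this.locallyIntegrable (by norm_num)
  rw [integral_schwartz_smul_fourierInv]
  -- Move the translation onto the test function; compact support makes the translate a Schwartz
  -- function again.
  have h1 : HasCompactSupport (fun x => φ (x - y)) :=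
    hφ.comp_homeomorph (Homeomorph.subRight y)
  have h2 : ContDiff ℝ ∞ (fun x => φ (x - y)) := by
    have := φ.smooth (⊤ : ℕ∞)
    fun_prop
  set ψ := h1.toSchwartzMap h2 with hψ
  have h3 := integral_schwartz_smul_fourierInv a ψ
  have h4 : ∫ x, φ x • (𝓕⁻ a : L2 N) (x + y) = ∫ x, ψ x • (𝓕⁻ a : L2 N) x := by
    rw [← integral_add_right_eq_self (fun x => ψ x • (𝓕⁻ a : L2 N) x) y]
    simp [hψ]
  rw [h4, h3]
  refine integral_congr_ae ?_
  filter_upwards [hb] with ξ hξ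
  rw [hξ]
  have : (𝓕⁻ ψ) ξ = Complex.exp (2 * Real.pi * (inner ℝ ξ y : ℝ) * Complex.I) * (𝓕⁻ φ) ξ := by
    rw [SchwartzMap.fourierInv_coe, SchwartzMap.fourierInv_coe, Real.fourierInv_eq', Real.fourierInv_eq',
      ← integral_add_right_eq_self _ y, ← integral_const_mul]
    congr 1
    ext x
    simp only [hψ, smul_eq_mul]
    rw [← mul_assoc, ← Complex.exp_add, inner_add_left, real_inner_comm ξ y]
    simp only [show ∀ z, (h1.toSchwartzMap h2) z = φ (z - y) from fun _ => rfl,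
      add_sub_cancel_right]
    congr 2
    push_cast
    ring
  rw [this]
  simp only [smul_eq_mul]; ring

theorem memLp_mul_of_bound {k : Space N → ℂ} {C : ℝ} (hk : Measurable k) (hC : ∀ x, ‖k x‖ ≤ C)
    (a : L2 N) : MemLp (fun x => k x * a x) 2 volume :=
  (Lp.memLp a).of_le_mul (c := C) (hk.aestronglyMeasurable.mul (Lp.aestronglyMeasurable a))
    (.of_forall fun x => by rw [norm_mul]; gcongr; exact hC x)

open Classical in
/-- Multiplication by a bounded measurable function on `L²` (zero for other functions). -/
def mulOp (k : Space N → ℂ) : L2 N →L[ℂ] L2 N :=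
  if h : Measurable k ∧ ∃ C, ∀ x, ‖k x‖ ≤ C then
    LinearMap.mkContinuous
      { toFun := fun a => (memLp_mul_of_bound h.1 h.2.choose_spec a).toLp
        map_add' := fun a b => by
          rw [← MemLp.toLp_add, MemLp.toLp_eq_toLp_iff]
          filter_upwards [Lp.coeFn_add a b] with x hx
          simp only [hx, Pi.add_apply, mul_add]
        map_smul' := fun c a => by
          rw [RingHom.id_apply, ← MemLp.toLp_const_smul, MemLp.toLp_eq_toLp_iff]
          filter_upwards [Lp.coeFn_smul c a] with x hx
          simp only [hx, Pi.smul_apply, smul_eq_mul, mul_left_comm] }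
      h.2.choose (fun a => by
        refine Lp.norm_le_mul_norm_of_ae_le_mul ?_
        filter_upwards [(memLp_mul_of_bound h.1 h.2.choose_spec a).coeFn_toLp] with x hx
        simp only [LinearMap.coe_mk, AddHom.coe_mk]
        rw [hx, norm_mul]
        gcongr
        exact h.2.choose_spec x)
  else 0

theorem mulOp_coe {k : Space N → ℂ} {C : ℝ} (hk : Measurable k) (hC : ∀ x, ‖k x‖ ≤ C) (a : L2 N) :
    (mulOp k a : Space N → ℂ) =ᵐ[volume] fun x => k x * a x := by
  have h : Measurable k ∧ ∃ C, ∀ x, ‖k x‖ ≤ C := ⟨hk, C, hC⟩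
  rw [mulOp, dif_pos h]
  exact (memLp_mul_of_bound h.1 h.2.choose_spec a).coeFn_toLp

theorem norm_mulOp_le {k : Space N → ℂ} {C : ℝ} (hk : Measurable k) (hC : ∀ x, ‖k x‖ ≤ C)
    (a : L2 N) : ‖mulOp k a‖ ≤ C * ‖a‖ := by
  refine Lp.norm_le_mul_norm_of_ae_le_mul ?_
  filter_upwards [mulOp_coe hk hC a] with x hx
  rw [hx, norm_mul]
  gcongr
  exact hC x

theorem norm_L2_sq (a : L2 N) : ‖a‖ ^ 2 = ∫ x, ‖a x‖ ^ 2 := by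
  have h := L2.inner_def (𝕜 := ℂ) a a
  rw [inner_self_eq_norm_sq_to_K] at h
  have h2 : ∫ x, inner ℂ (a x) (a x) = ((∫ x, ‖a x‖ ^ 2 : ℝ) : ℂ) := by
    rw [← integral_complex_ofReal]
    congr 1; ext x
    rw [inner_self_eq_norm_sq_to_K]; norm_cast
  rw [h2] at h
  exact Complex.ofReal_injective (by rw [← h]; norm_cast)

/-- Sequential weak convergence in `L²`. -/
def WeakTendsto (a : ℕ → L2 N) (b : L2 N) : Prop :=
  ∀ c : L2 N, Tendsto (fun n => inner ℂ c (a n)) atTop (𝓝 (inner ℂ c b))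

/-- Sequential Banach–Alaoglu in the dual of the separable space `L²`. The Riesz pairing has its
arguments in the opposite order, hence the final conjugation. -/
theorem exists_weakTendsto_subseq (a : ℕ → L2 N) (C : ℝ) (hC : ∀ n, ‖a n‖ ≤ C) :
    ∃ b : L2 N, ∃ k : ℕ → ℕ, StrictMono k ∧ WeakTendsto (a ∘ k) b := by
  have : Fact ((2 : ℝ≥0∞) ≠ ⊤) := ⟨by norm_num⟩
  have : SecondCountableTopology (L2 N) := Lp.SecondCountableTopology
  obtain ⟨l, -, k, hk, hl⟩ := WeakDual.isSeqCompact_closedBall ℂ (L2 N) 0 C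
    (x := fun n => StrongDual.toWeakDual (InnerProductSpace.toDual ℂ (L2 N) (a n)))
    (fun n => by simpa using hC n)
  refine ⟨(InnerProductSpace.toDual ℂ (L2 N)).symm (WeakDual.toStrongDual l), k, hk, fun c => ?_⟩
  have h1 := ((WeakDual.eval_continuous c).tendsto l).comp hl
  have h2 := (Complex.continuous_conj.tendsto _).comp h1
  convert h2 using 2
  · simp [Function.comp]
  · rw [← inner_conj_symm, InnerProductSpace.toDual_symm_apply]; rfl

end FracSP

/-! ### Fourier multipliers and the representation of `H^s` on the Fourier side -/

namespace FracSP

variable {N : ℕ}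

/-- The Fourier multiplier operator `a ↦ 𝓕⁻ (k a)`, applied to functions given on the Fourier
side. -/
def fmul (k : Space N → ℂ) : L2 N →L[ℂ] L2 N :=
  ((Lp.fourierTransformₗᵢ (Space N) ℂ).symm : L2 N →L[ℂ] L2 N).comp (mulOp k)

theorem fmul_apply (k : Space N → ℂ) (a : L2 N) : fmul k a = 𝓕⁻ (mulOp k a) := rfl

theorem norm_fourierInv (a : L2 N) : ‖(𝓕⁻ a : L2 N)‖ = ‖a‖ :=
  (Lp.fourierTransformₗᵢ (Space N) ℂ).symm.norm_map a

theorem norm_fmul_le {k : Space N → ℂ} {C : ℝ} (hk : Measurable k) (hC : ∀ x, ‖k x‖ ≤ C)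
    (a : L2 N) : ‖fmul k a‖ ≤ C * ‖a‖ := by
  rw [fmul_apply, norm_fourierInv]
  exact norm_mulOp_le hk hC a

/-- The character `ξ ↦ exp (2πi ⟨ξ, y⟩)`. -/
def char (y ξ : Space N) : ℂ := Complex.exp (2 * Real.pi * (inner ℝ ξ y : ℝ) * Complex.I)

theorem norm_char (y ξ : Space N) : ‖char y ξ‖ = 1 := by
  rw [char, show (2 * Real.pi * (inner ℝ ξ y : ℝ) * Complex.I : ℂ) =
    ((2 * Real.pi * inner ℝ ξ y : ℝ) : ℂ) * Complex.I by push_cast; ring]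
  exact Complex.norm_exp_ofReal_mul_I _

theorem conj_char (y ξ : Space N) : (starRingEnd ℂ) (char y ξ) = char (-y) ξ := by
  rw [char, char, ← Complex.exp_conj, inner_neg_right]
  simp [Complex.conj_ofReal, map_ofNat]

theorem measurable_char (y : Space N) : Measurable (char y) := by
  unfold char; fun_prop

/-- Multiplication by a character: translation on the Fourier side. -/
def shift (y : Space N) : L2 N →L[ℂ] L2 N := mulOp (char y)

theorem shift_coe (y : Space N) (a : L2 N) :
    (shift y a : Space N → ℂ) =ᵐ[volume] fun ξ => char y ξ * a ξ :=
  mulOp_coe (measurable_char y) (fun ξ => (norm_char y ξ).le) a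

theorem norm_shift (y : Space N) (a : L2 N) : ‖shift y a‖ = ‖a‖ := by
  have h : ∀ᵐ ξ, ‖shift y a ξ‖ = ‖a ξ‖ := by
    filter_upwards [shift_coe y a] with ξ h
    rw [h, norm_mul, norm_char, one_mul]
  exact le_antisymm (Lp.norm_le_norm_of_ae_le (h.mono fun _ => le_of_eq))
    (Lp.norm_le_norm_of_ae_le (h.mono fun _ h => h.ge))

theorem inner_shift (y : Space N) (a b : L2 N) :
    inner ℂ b (shift y a) = inner ℂ (shift (-y) b) a := by
  rw [L2.inner_def, L2.inner_def]
  refine integral_congr_ae ?_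
  filter_upwards [shift_coe y a, shift_coe (-y) b] with ξ h1 h2
  rw [h1, h2]
  simp only [RCLike.inner_apply, map_mul, conj_char, neg_neg]
  ring

theorem WeakTendsto.shift {a : ℕ → L2 N} {b : L2 N} (h : WeakTendsto a b) (y : Space N) :
    WeakTendsto (fun n => shift y (a n)) (shift y b) := fun c => by
  simp only [inner_shift]
  exact h _

theorem fmul_shift_ae {k : Space N → ℂ} {C : ℝ} (hk : Measurable k) (hC : ∀ x, ‖k x‖ ≤ C)
    (y : Space N) (a : L2 N) :
    (fmul k (shift y a) : Space N → ℂ) =ᵐ[volume] fun x => fmul k a (x + y) := by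
  rw [fmul_apply, fmul_apply]
  refine fourierInv_translate y _ _ ?_
  filter_upwards [mulOp_coe hk hC (shift y a), mulOp_coe hk hC a, shift_coe y a] with ξ h1 h2 h3
  rw [h1, h2, h3, char]; ring

/-! ### Band limited multipliers and point evaluation -/

section Band

variable {k : Space N → ℂ} {C R : ℝ}

theorem memLp_conj_of_band (hk : Measurable k) (hC : ∀ x, ‖k x‖ ≤ C)
    (hR : ∀ x, R ≤ ‖x‖ → k x = 0) : MemLp (fun ξ => (starRingEnd ℂ) (k ξ)) 2 volume := by
  have h1 : MemLp ((Metric.ball (0 : Space N) R).indicator fun _ => C) 2 volume :=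
    memLp_indicator_const 2 measurableSet_ball C (.inr measure_ball_lt_top.ne)
  refine h1.of_le (Complex.continuous_conj.measurable.comp hk).aestronglyMeasurable
    (.of_forall fun x => ?_)
  by_cases hx : ‖x‖ < R
  · rw [Set.indicator_of_mem (by simpa using hx)]
    simpa using (hC x).trans (le_abs_self C)
  · simp [hR x (not_lt.1 hx)]

open Classical in
/-- The `L²` function representing evaluation at the origin after a band limited multiplier. -/
def evalZero (k : Space N → ℂ) : L2 N :=
  if h : MemLp (fun ξ => (starRingEnd ℂ) (k ξ)) 2 volume then h.toLp else 0

theorem evalZero_coe (hk : Measurable k) (hC : ∀ x, ‖k x‖ ≤ C)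
    (hR : ∀ x, R ≤ ‖x‖ → k x = 0) :
    (evalZero k : Space N → ℂ) =ᵐ[volume] fun ξ => (starRingEnd ℂ) (k ξ) := by
  have h := memLp_conj_of_band hk hC hR
  rw [evalZero, dif_pos h]
  exact h.coeFn_toLp

theorem norm_evalZero_sq_le (hk : Measurable k) (hC : ∀ x, ‖k x‖ ≤ C)
    (hR : ∀ x, R ≤ ‖x‖ → k x = 0) :
    ‖evalZero k‖ ^ 2 ≤ C ^ 2 * volume.real (Metric.ball (0 : Space N) R) := by
  rw [norm_L2_sq]
  calc ∫ x, ‖evalZero k x‖ ^ 2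
      ≤ ∫ x, (Metric.ball (0 : Space N) R).indicator (fun _ => C ^ 2) x := by
        refine integral_mono_ae (memLp_two_iff_integrable_sq_norm
          (Lp.aestronglyMeasurable _) |>.1 (Lp.memLp _))
          ((integrable_indicator_iff measurableSet_ball).2
            (integrableOn_const measure_ball_lt_top.ne)) ?_
        filter_upwards [evalZero_coe hk hC hR] with x hx
        rw [hx, RCLike.norm_conj]
        by_cases hxR : ‖x‖ < R
        · rw [Set.indicator_of_mem (by simpa using hxR)]
          gcongr; exact hC x
        · rw [hR x (not_lt.1 hxR), Set.indicator_of_notMem (by simpa using hxR)]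
          simp
    _ = _ := by
        rw [integral_indicator measurableSet_ball, setIntegral_const, smul_eq_mul, mul_comm]

/-- A product of two `L²` functions is integrable, so the inverse transform is an honest integral at
each point, and that integral is an inner product. Weak convergence thus becomes pointwise
convergence of low frequency parts. -/
theorem fmul_band_ae (hk : Measurable k) (hC : ∀ x, ‖k x‖ ≤ C)
    (hR : ∀ x, R ≤ ‖x‖ → k x = 0) (a : L2 N) :
    (fmul k a : Space N → ℂ) =ᵐ[volume] fun x => inner ℂ (evalZero k) (shift x a) := by
  have hconj : ∀ᵐ ξ, evalZero k ξ = (starRingEnd ℂ) (k ξ) := evalZero_coe hk hC hR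
  have hint : Integrable (mulOp k a : Space N → ℂ) := by
    have h1 := L2.integrable_inner (𝕜 := ℂ) (evalZero k) a
    refine h1.congr ?_
    filter_upwards [hconj, mulOp_coe hk hC a] with ξ h2 h3
    rw [h2, h3]; simp [mul_comm]
  rw [fmul_apply]
  filter_upwards [fourierInv_ae_eq _ hint] with x hx
  rw [hx, Real.fourierInv_eq', L2.inner_def]
  refine integral_congr_ae ?_
  filter_upwards [hconj, mulOp_coe hk hC a, shift_coe x a] with ξ h2 h3 h4
  rw [h2, h3, h4, char]
  simp only [smul_eq_mul, RCLike.inner_apply, Complex.conj_conj]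
  push_cast; ring

theorem norm_inner_evalZero_le (a : L2 N) (x : Space N) :
    ‖inner ℂ (evalZero k) (shift x a)‖ ≤ ‖evalZero k‖ * ‖a‖ := by
  simpa [norm_shift] using norm_inner_le_norm (𝕜 := ℂ) (evalZero k) (shift x a)

end Band

/-- Interpolation between `L²` and `L^∞`. -/
theorem eLpNorm_le_of_bound {p : ℝ} (hp : 2 ≤ p) {M : ℝ} (hM : 0 ≤ M) (b : L2 N)
    (hb : ∀ᵐ x, ‖b x‖ ≤ M) :
    eLpNorm b (ENNReal.ofReal p) volume ≤ ENNReal.ofReal (M ^ (1 - 2 / p) * ‖b‖ ^ (2 / p)) := by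
  have hp0 : 0 < p := by linarith
  have h2 : eLpNorm b 2 volume = ENNReal.ofReal ‖b‖ := by
    rw [Lp.norm_def, ENNReal.ofReal_toReal (Lp.eLpNorm_ne_top b)]
  have h3 : ∫⁻ x, ‖b x‖ₑ ^ p ≤ ENNReal.ofReal (M ^ (p - 2)) * ENNReal.ofReal ‖b‖ ^ (2 : ℝ) := by
    rw [← h2, eLpNorm_eq_lintegral_rpow_enorm_toReal (by norm_num) (by norm_num),
      ← ENNReal.rpow_mul]
    simp only [ENNReal.toReal_ofNat]
    rw [show (1 / 2 * 2 : ℝ) = 1 by norm_num, ENNReal.rpow_one,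
      ← lintegral_const_mul' _ _ ENNReal.ofReal_ne_top]
    refine lintegral_mono_ae ?_
    filter_upwards [hb] with x hx
    rw [← ofReal_norm, ENNReal.ofReal_rpow_of_nonneg (norm_nonneg _) hp0.le,
      ENNReal.ofReal_rpow_of_nonneg (norm_nonneg _) (by norm_num), ← ENNReal.ofReal_mul (by positivity)]
    refine ENNReal.ofReal_le_ofReal ?_
    calc ‖b x‖ ^ p = ‖b x‖ ^ (p - 2) * ‖b x‖ ^ (2 : ℝ) := by
          rw [← Real.rpow_add_of_nonneg (norm_nonneg _) (by linarith) (by norm_num)]; ring_nf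
      _ ≤ _ := by gcongr
  rw [eLpNorm_eq_lintegral_rpow_enorm_toReal (by simpa using hp0) ENNReal.ofReal_ne_top,
    ENNReal.toReal_ofReal hp0.le]
  calc (∫⁻ x, ‖b x‖ₑ ^ p) ^ (1 / p)
      ≤ (ENNReal.ofReal (M ^ (p - 2)) * ENNReal.ofReal ‖b‖ ^ (2 : ℝ)) ^ (1 / p) := by gcongr
    _ = _ := by
        rw [ENNReal.ofReal_rpow_of_nonneg (norm_nonneg _) (by norm_num), ← ENNReal.ofReal_mul (by positivity),
          ENNReal.ofReal_rpow_of_nonneg (by positivity) (by positivity),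
          Real.mul_rpow (by positivity) (by positivity), ← Real.rpow_mul hM,
          ← Real.rpow_mul (norm_nonneg _)]
        congr 3
        · field_simp
        · field_simp

/-! ### The space `H^s` on the Fourier side -/

/-- The weight `((2π|ξ|)^{2s} + μ)^{1/2}`. -/
def wt (s μ : ℝ) (ξ : Space N) : ℝ := Real.sqrt (((2 * Real.pi * ‖ξ‖) ^ s) ^ 2 + μ)

theorem measurable_wt (s μ : ℝ) : Measurable (wt s μ : Space N → ℝ) := by
  unfold wt; fun_prop

theorem wt_sq {s μ : ℝ} (hμ : 0 < μ) (ξ : Space N) :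
    wt s μ ξ ^ 2 = ((2 * Real.pi * ‖ξ‖) ^ s) ^ 2 + μ := Real.sq_sqrt (by positivity)

theorem sqrt_le_wt {s μ : ℝ} (ξ : Space N) : Real.sqrt μ ≤ wt s μ ξ :=
  Real.sqrt_le_sqrt (by nlinarith [sq_nonneg ((2 * Real.pi * ‖ξ‖) ^ s)])

theorem wt_pos {s μ : ℝ} (hμ : 0 < μ) (ξ : Space N) : 0 < wt s μ ξ :=
  (Real.sqrt_pos.2 hμ).trans_le (sqrt_le_wt ξ)

theorem rpow_le_wt {s μ : ℝ} (hμ : 0 < μ) (ξ : Space N) : (2 * Real.pi * ‖ξ‖) ^ s ≤ wt s μ ξ :=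
  Real.le_sqrt_of_sq_le (by linarith)

/-- The multiplier `((2π|ξ|)^{2s} + μ)^{-1/2}`. -/
def invWt (s μ : ℝ) (ξ : Space N) : ℂ := ((wt s μ ξ)⁻¹ : ℝ)

theorem measurable_invWt (s μ : ℝ) : Measurable (invWt s μ : Space N → ℂ) :=
  Complex.measurable_ofReal.comp (measurable_wt s μ).inv

theorem norm_invWt {s μ : ℝ} (hμ : 0 < μ) (ξ : Space N) : ‖invWt s μ ξ‖ = (wt s μ ξ)⁻¹ := by
  rw [invWt, Complex.norm_real, Real.norm_of_nonneg (inv_nonneg.2 (wt_pos hμ ξ).le)]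

theorem norm_invWt_le {s μ : ℝ} (hμ : 0 < μ) (ξ : Space N) :
    ‖invWt s μ ξ‖ ≤ (Real.sqrt μ)⁻¹ := by
  rw [norm_invWt hμ]
  exact inv_anti₀ (Real.sqrt_pos.2 hμ) (sqrt_le_wt ξ)

/-- `a ∈ L²` represents the real function `u ∈ H^s` if `𝓕 u = ((2π|ξ|)^{2s} + μ)^{-1/2} a`. -/
def Rep (s μ : ℝ) (u : Space N → ℝ) (a : L2 N) : Prop :=
  (fmul (invWt s μ) a : Space N → ℂ) =ᵐ[volume] fun x => (u x : ℂ)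

section Rep

variable {s μ : ℝ} {u v : Space N → ℝ} {a b : L2 N}

theorem Rep.memLp_ofReal (h : Rep s μ u a) : MemLp (fun x => (u x : ℂ)) 2 volume :=
  (memLp_congr_ae h).1 (Lp.memLp _)

theorem Rep.memLp (h : Rep s μ u a) : MemLp u 2 volume := by
  simpa using h.memLp_ofReal.re

theorem memLp_ofReal {p : ℝ≥0∞} (h : MemLp u p volume) : MemLp (fun x => (u x : ℂ)) p volume :=
  h.ofReal

theorem Rep.fourierL2_ae (hμ : 0 < μ) (h : Rep s μ u a) :
    fourierL2 u =ᵐ[volume] fun ξ => invWt s μ ξ * a ξ := by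
  rw [fourierL2, dif_pos h.memLp_ofReal]
  have : h.memLp_ofReal.toLp (fun x => (u x : ℂ)) = fmul (invWt s μ) a :=
    Lp.ext (h.memLp_ofReal.coeFn_toLp.trans h.symm)
  rw [this, fmul_apply, FourierTransform.fourier_fourierInv_eq]
  exact mulOp_coe (measurable_invWt s μ) (norm_invWt_le hμ) a

theorem Rep.fracMultiplier_ae (hμ : 0 < μ) (h : Rep s μ u a) :
    fracMultiplier (s / 2) u =ᵐ[volume]
      fun ξ => (((2 * Real.pi * ‖ξ‖) ^ s * (wt s μ ξ)⁻¹ : ℝ) : ℂ) * a ξ := by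
  filter_upwards [h.fourierL2_ae hμ] with ξ hξ
  rw [fracMultiplier, hξ, invWt, show 2 * (s / 2) = s by ring]
  push_cast; ring

theorem Rep.memHs (hμ : 0 < μ) (h : Rep s μ u a) : MemHs s u := by
  refine ⟨h.memLp, (memLp_congr_ae (h.fracMultiplier_ae hμ)).2 ?_⟩
  refine memLp_mul_of_bound (C := 1) ?_ (fun ξ => ?_) a
  · have := measurable_wt (N := N) s μ
    fun_prop
  · rw [Complex.norm_real, Real.norm_of_nonneg
      (mul_nonneg (by positivity) (inv_nonneg.2 (wt_pos hμ ξ).le)),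
      ← div_eq_mul_inv, div_le_one (wt_pos hμ ξ)]
    exact rpow_le_wt hμ ξ

theorem Rep.integral_sq (h : Rep s μ u a) : ∫ x, u x ^ 2 = ‖fmul (invWt s μ) a‖ ^ 2 := by
  rw [norm_L2_sq]
  refine integral_congr_ae ?_
  filter_upwards [h] with x hx
  rw [hx, Complex.norm_real, Real.norm_eq_abs, sq_abs]

theorem integrable_norm_sq (a : L2 N) : Integrable (fun x => ‖a x‖ ^ 2) :=
  (memLp_two_iff_integrable_sq_norm (Lp.aestronglyMeasurable _)).1 (Lp.memLp _)

/-- By Plancherel, since `wt² = (2π|ξ|)^{2s} + μ`. With `μ = V₀` the quadratic form of the limit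
problem becomes a Hilbert norm squared. -/
theorem Rep.norm_sq (hμ : 0 < μ) (h : Rep s μ u a) :
    ‖fracLap (s / 2) u‖ ^ 2 + μ * ∫ x, u x ^ 2 = ‖a‖ ^ 2 := by
  have hm := (h.memHs hμ).2
  rw [h.integral_sq, fracLap, dif_pos hm, norm_fourierInv, fmul_apply, norm_fourierInv,
    norm_L2_sq, norm_L2_sq, norm_L2_sq, ← integral_const_mul,
    ← integral_add (integrable_norm_sq _) ((integrable_norm_sq _).const_mul μ)]
  refine integral_congr_ae ?_
  filter_upwards [hm.coeFn_toLp, h.fracMultiplier_ae hμ,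
    mulOp_coe (measurable_invWt s μ) (norm_invWt_le hμ) a] with ξ h1 h2 h3
  have h4 := wt_pos (s := s) hμ ξ
  have h5 := wt_sq (s := s) hμ ξ
  rw [h1, h2, h3, norm_mul, norm_mul, norm_invWt hμ, Complex.norm_real,
    Real.norm_of_nonneg (mul_nonneg (by positivity) (inv_nonneg.2 h4.le))]
  rw [show ((2 * Real.pi * ‖ξ‖) ^ s * (wt s μ ξ)⁻¹ * ‖a ξ‖) ^ 2 + μ * ((wt s μ ξ)⁻¹ * ‖a ξ‖) ^ 2
    = (((2 * Real.pi * ‖ξ‖) ^ s) ^ 2 + μ) * ((wt s μ ξ) ^ 2)⁻¹ * ‖a ξ‖ ^ 2 by ring, ← h5,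
    mul_inv_cancel₀ (by positivity), one_mul]

theorem MemHs.exists_rep (hμ : 0 < μ) (h : MemHs s u) : ∃ a, Rep s μ u a := by
  have hu := memLp_ofReal h.1
  have hw : MemLp (fun ξ => (wt s μ ξ : ℂ) * fourierL2 u ξ) 2 volume := by
    have hf : MemLp (fourierL2 u) 2 volume := by
      rw [fourierL2, dif_pos hu]; exact Lp.memLp _
    -- The candidate `wt · 𝓕u` is square integrable because `√(A² + μ) ≤ A + √μ`.
    have h1 : MemLp (fun ξ => ‖fracMultiplier (s / 2) u ξ‖ + Real.sqrt μ * ‖fourierL2 u ξ‖) 2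
      volume := h.2.norm.add (hf.norm.const_mul _)
    refine h1.of_le ((Complex.measurable_ofReal.comp (measurable_wt s μ)).aestronglyMeasurable.mul
      hf.aestronglyMeasurable) (.of_forall fun ξ => ?_)
    rw [norm_mul, Complex.norm_real, Real.norm_of_nonneg (wt_pos hμ ξ).le,
      Real.norm_of_nonneg (by positivity), fracMultiplier, norm_mul, Complex.norm_real,
      show 2 * (s / 2) = s by ring, Real.norm_of_nonneg (by positivity), ← add_mul]
    gcongr
    refine Real.sqrt_le_iff.2 ⟨by positivity, ?_⟩
    have : 0 ≤ (2 * Real.pi * ‖ξ‖) ^ s * Real.sqrt μ := by positivity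
    nlinarith [Real.sq_sqrt hμ.le]
  refine ⟨hw.toLp, ?_⟩
  have : fmul (invWt s μ) (hw.toLp) = hu.toLp := by
    rw [fmul_apply, ← FourierTransform.fourierInv_fourier_eq (F := L2 N) (hu.toLp (fun x => (u x : ℂ)))]
    congr 1
    refine Lp.ext ?_
    have h1 : fourierL2 u = (𝓕 (hu.toLp (fun x => (u x : ℂ))) : L2 N) := by
      rw [fourierL2, dif_pos hu]
    rw [← h1]
    filter_upwards [mulOp_coe (measurable_invWt s μ) (norm_invWt_le hμ) hw.toLp, hw.coeFn_toLp]
      with ξ h2 h3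
    have h4 : (wt s μ ξ : ℂ) ≠ 0 := Complex.ofReal_ne_zero.2 (wt_pos hμ ξ).ne'
    rw [h2, h3, invWt, Complex.ofReal_inv, inv_mul_cancel_left₀ h4]
  rw [Rep, this]
  exact hu.coeFn_toLp

theorem Rep.sub (hu : Rep s μ u a) (hv : Rep s μ v b) : Rep s μ (u - v) (a - b) := by
  rw [Rep, map_sub]
  filter_upwards [hu, hv, Lp.coeFn_sub (fmul (invWt s μ) a) (fmul (invWt s μ) b)] with x h1 h2 h3
  rw [h3, Pi.sub_apply, h1, h2]; simp

theorem Rep.smul (hu : Rep s μ u a) (t : ℝ) : Rep s μ (fun x => t * u x) ((t : ℂ) • a) := by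
  rw [Rep, map_smul]
  filter_upwards [hu, Lp.coeFn_smul (t : ℂ) (fmul (invWt s μ) a)] with x h1 h3
  rw [h3, Pi.smul_apply, h1]; simp

theorem Rep.shift (hμ : 0 < μ) (hu : Rep s μ u a) (y : Space N) :
    Rep s μ (fun x => u (x + y)) (shift y a) := by
  rw [Rep]
  filter_upwards [fmul_shift_ae (measurable_invWt s μ) (norm_invWt_le hμ) y a,
    (measurePreserving_add_right volume y).quasiMeasurePreserving.ae hu] with x h1 h2
  rw [h1, h2]

theorem Rep.integral_sq_le (hμ : 0 < μ) (h : Rep s μ u a) : μ * ∫ x, u x ^ 2 ≤ ‖a‖ ^ 2 := by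
  rw [← h.norm_sq hμ]; linarith [sq_nonneg ‖fracLap (s / 2) u‖]

theorem Rep.hsNorm_le (hμ : 0 < μ) (h : Rep s μ u a) :
    hsNorm s u ≤ Real.sqrt (1 + μ⁻¹) * ‖a‖ := by
  rw [hsNorm, ← Real.sqrt_sq (norm_nonneg a), ← Real.sqrt_mul (by positivity)]
  refine Real.sqrt_le_sqrt ?_
  have h1 := h.norm_sq hμ
  have h2 := h.integral_sq_le hμ
  have h3 : ∫ x, u x ^ 2 ≤ μ⁻¹ * ‖a‖ ^ 2 := by rwa [le_inv_mul_iff₀ hμ]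
  have : 0 ≤ μ * ∫ x, u x ^ 2 := mul_nonneg hμ.le (integral_nonneg fun _ => sq_nonneg _)
  linarith

theorem Rep.ne_zero (h : Rep s μ u a) (hu : ¬ u =ᵐ[volume] 0) : a ≠ 0 := by
  rintro rfl
  refine hu ?_
  have h' := h
  rw [Rep, map_zero] at h'
  filter_upwards [h', Lp.coeFn_zero ℂ 2 (volume : Measure (Space N))] with x h1 h2
  rw [h2] at h1
  simpa using h1.symm

theorem Rep.eq_zero_of_ae (hμ : 0 < μ) (h : Rep s μ u a) (hu : u =ᵐ[volume] 0) : a = 0 := by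
  have h1 := h.norm_sq hμ
  have h2 : ∫ x, u x ^ 2 = 0 := by
    rw [integral_congr_ae (g := fun _ => 0) (by filter_upwards [hu] with x hx; simp [hx])]; simp
  have h3 : fmul (invWt s μ) a = 0 := by
    rw [h.integral_sq] at h2
    simpa using h2
  have h4 : mulOp (invWt s μ) a = 0 := by
    rw [fmul_apply] at h3
    rw [← norm_eq_zero, ← norm_fourierInv, h3, norm_zero]
  refine Lp.ext ?_
  filter_upwards [mulOp_coe (measurable_invWt s μ) (norm_invWt_le hμ) a,
    Lp.coeFn_zero ℂ 2 (volume : Measure (Space N))] with ξ h5 h6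
  rw [h4, h6] at h5
  have h7 : invWt s μ ξ ≠ 0 := by
    rw [← norm_ne_zero_iff, norm_invWt hμ]; exact (inv_pos.2 (wt_pos hμ ξ)).ne'
  rw [h6]
  simpa [h7] using h5.symm

end Rep

end FracSP

/-! ### Sobolev inequality, nonvanishing and local compactness -/

namespace FracSP

variable {N : ℕ}

theorem fmul_sub {k l : Space N → ℂ} {C D : ℝ} (hk : Measurable k) (hC : ∀ x, ‖k x‖ ≤ C)
    (hl : Measurable l) (hD : ∀ x, ‖l x‖ ≤ D) (a : L2 N) :
    fmul (k - l) a = fmul k a - fmul l a := by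
  have h : mulOp (k - l) a = mulOp k a - mulOp l a := by
    refine Lp.ext ?_
    have hb : ∀ x, ‖(k - l) x‖ ≤ C + D := fun x =>
      (norm_sub_le _ _).trans (add_le_add (hC x) (hD x))
    filter_upwards [mulOp_coe (hk.sub hl) hb a, mulOp_coe hk hC a, mulOp_coe hl hD a,
      Lp.coeFn_sub (mulOp k a) (mulOp l a)] with x h1 h2 h3 h4
    rw [h1, h4, Pi.sub_apply, Pi.sub_apply, h2, h3, sub_mul]
  rw [fmul, ContinuousLinearMap.comp_apply, h, map_sub]; rfl

theorem volume_real_ball {r : ℝ} (hr : 0 < r) :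
    volume.real (Metric.ball (0 : Space N) r) =
      r ^ N * volume.real (Metric.ball (0 : Space N) 1) := by
  have := Measure.addHaar_ball_mul_of_pos (volume : Measure (Space N)) 0 hr 1
  rw [mul_one, finrank_euclideanSpace_fin] at this
  rw [measureReal_def, measureReal_def, this, ENNReal.toReal_mul,
    ENNReal.toReal_ofReal (by positivity)]

/-- A Bernstein inequality: Cauchy–Schwarz in the evaluation formula bounds the supremum, Plancherel
bounds the `L²` norm, and interpolation gives `L^p`. -/
theorem eLpNorm_fmul_band_le {k : Space N → ℂ} {C R p : ℝ} (hp : 2 ≤ p)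
    (hC0 : 0 ≤ C) (hk : Measurable k) (hC : ∀ x, ‖k x‖ ≤ C) (hR : ∀ x, R ≤ ‖x‖ → k x = 0)
    (a : L2 N) :
    eLpNorm (fmul k a) (ENNReal.ofReal p) volume ≤ ENNReal.ofReal
      (C * (volume.real (Metric.ball (0 : Space N) R)) ^ (1 / 2 - 1 / p) * ‖a‖) := by
  set v := volume.real (Metric.ball (0 : Space N) R) with hv
  have hv0 : 0 ≤ v := measureReal_nonneg
  have hp0 : 0 < p := by linarith
  have h2p : 0 ≤ 1 - 2 / p := by rw [sub_nonneg, div_le_one hp0]; exact hp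
  have he : ‖evalZero k‖ ≤ C * Real.sqrt v := by
    refine abs_le_of_sq_le_sq' ?_ (by positivity) |>.2
    rw [mul_pow, Real.sq_sqrt hv0]
    exact norm_evalZero_sq_le hk hC hR
  have hM : ∀ᵐ x, ‖fmul k a x‖ ≤ C * Real.sqrt v * ‖a‖ := by
    filter_upwards [fmul_band_ae hk hC hR a] with x hx
    rw [hx]
    exact (norm_inner_evalZero_le a x).trans (by gcongr)
  refine (eLpNorm_le_of_bound hp (by positivity) _ hM).trans (ENNReal.ofReal_le_ofReal ?_)
  calc (C * Real.sqrt v * ‖a‖) ^ (1 - 2 / p) * ‖fmul k a‖ ^ (2 / p)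
      ≤ (C * Real.sqrt v * ‖a‖) ^ (1 - 2 / p) * (C * ‖a‖) ^ (2 / p) := by
        gcongr; exact norm_fmul_le hk hC a
    _ = (C * ‖a‖) ^ (1 - 2 / p) * (C * ‖a‖) ^ (2 / p) * Real.sqrt v ^ (1 - 2 / p) := by
        rw [mul_right_comm, Real.mul_rpow (by positivity) (by positivity)]; ring
    _ = _ := by
        rw [← Real.rpow_add_of_nonneg (by positivity) h2p (by positivity), Real.sqrt_eq_rpow,
          ← Real.rpow_mul hv0, show 1 - 2 / p + 2 / p = 1 by ring, Real.rpow_one,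
          show 1 / 2 * (1 - 2 / p) = 1 / 2 - 1 / p by ring]
        ring

/-- The restriction of the multiplier `invWt` to frequencies below `2^J`. -/
def lowSym (s μ : ℝ) (J : ℕ) (ξ : Space N) : ℂ := if ‖ξ‖ < 2 ^ J then invWt s μ ξ else 0

section Sobolev

variable {s μ p : ℝ}

theorem measurable_lowSym (J : ℕ) : Measurable (lowSym s μ J : Space N → ℂ) :=
  Measurable.ite (measurableSet_lt measurable_norm measurable_const) (measurable_invWt s μ)
    measurable_const

theorem norm_lowSym_le (hμ : 0 < μ) (J : ℕ) (ξ : Space N) :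
    ‖lowSym s μ J ξ‖ ≤ (Real.sqrt μ)⁻¹ := by
  rw [lowSym]
  split_ifs
  · exact norm_invWt_le hμ ξ
  · simp

theorem lowSym_eq_zero (J : ℕ) (ξ : Space N) (h : 2 ^ J ≤ ‖ξ‖) : lowSym s μ J ξ = 0 :=
  if_neg (not_lt.2 h)

theorem norm_invWt_le_of_le (hs : 0 < s) (hμ : 0 < μ) {J : ℕ} {ξ : Space N} (h : 2 ^ J ≤ ‖ξ‖) :
    ‖invWt s μ ξ‖ ≤ ((2 : ℝ) ^ (-s)) ^ J := by
  rw [norm_invWt hμ, ← Real.rpow_mul_natCast (by norm_num), neg_mul, Real.rpow_neg (by norm_num)]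
  refine inv_anti₀ (by positivity) (le_trans ?_ (rpow_le_wt hμ ξ))
  rw [mul_comm, Real.rpow_natCast_mul (by norm_num)]
  refine Real.rpow_le_rpow (by positivity) (h.trans ?_) hs.le
  nlinarith [Real.pi_gt_three, norm_nonneg ξ]

theorem norm_invWt_sub_lowSym_le (hs : 0 < s) (hμ : 0 < μ) (J : ℕ) (ξ : Space N) :
    ‖(invWt s μ - lowSym s μ J : Space N → ℂ) ξ‖ ≤ ((2 : ℝ) ^ (-s)) ^ J := by
  rw [Pi.sub_apply, lowSym]
  split_ifs with h
  · simp only [sub_self, norm_zero]; positivity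
  · rw [sub_zero]; exact norm_invWt_le_of_le hs hμ (not_lt.1 h)

theorem norm_lowSym_succ_sub_le (hs : 0 < s) (hμ : 0 < μ) (J : ℕ) (ξ : Space N) :
    ‖(lowSym s μ (J + 1) - lowSym s μ J : Space N → ℂ) ξ‖ ≤ ((2 : ℝ) ^ (-s)) ^ J := by
  rw [Pi.sub_apply, lowSym, lowSym]
  by_cases h : ‖ξ‖ < 2 ^ J
  · rw [if_pos h, if_pos (h.trans (by gcongr <;> norm_num))]
    simp only [sub_self, norm_zero]; positivity
  · rw [if_neg h, sub_zero]
    split_ifs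
    · exact norm_invWt_le_of_le hs hμ (not_lt.1 h)
    · simp only [norm_zero]; positivity

theorem two_rpow_neg_lt_one (hs : 0 < s) : (2 : ℝ) ^ (-s) < 1 :=
  Real.rpow_lt_one_of_one_lt_of_neg (by norm_num) (by linarith)

theorem norm_fmul_high_le (hs : 0 < s) (hμ : 0 < μ) (J : ℕ) (a : L2 N) :
    ‖fmul (invWt s μ) a - fmul (lowSym s μ J) a‖ ≤ ((2 : ℝ) ^ (-s)) ^ J * ‖a‖ := by
  rw [← fmul_sub (measurable_invWt s μ) (norm_invWt_le hμ) (measurable_lowSym J)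
    (norm_lowSym_le hμ J)]
  exact norm_fmul_le ((measurable_invWt s μ).sub (measurable_lowSym J))
    (norm_invWt_sub_lowSym_le hs hμ J) a

/-- On the shell `2^J ≤ |ξ| < 2^{J+1}` the symbol is at most `2^{-sJ}` and the volume is of order
`2^{NJ}`, so Bernstein gives a bound of order `ρ^J` with `ρ = 2^{N(1/2 - 1/p) - s}`. Subcriticality
means `ρ < 1`, and the shells sum geometrically. -/
theorem exists_eLpNorm_high_le (N : ℕ) (hs : 0 < s) (hμ : 0 < μ) (hp : 2 ≤ p)
    (hps : N * (1 / 2 - 1 / p) < s) :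
    ∃ A ρ : ℝ, 0 ≤ A ∧ 0 < ρ ∧ ρ < 1 ∧ ∀ (J : ℕ) (a : L2 N),
      eLpNorm (fmul (invWt s μ) a - fmul (lowSym s μ J) a : L2 N) (ENNReal.ofReal p) volume ≤
        ENNReal.ofReal (A * ρ ^ J * ‖a‖) := by
  set e := 1 / 2 - 1 / p with he
  have hp0 : 0 < p := by linarith
  have he0 : 0 ≤ e := by
    rw [he, sub_nonneg]; exact one_div_le_one_div_of_le (by norm_num) hp
  set κ := volume.real (Metric.ball (0 : Space N) 1)
  have hκ : 0 ≤ κ := measureReal_nonneg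
  set B : ℝ := (2 ^ N * κ) ^ e with hB
  have hB0 : 0 ≤ B := by positivity
  set ρ : ℝ := 2 ^ (N * e - s) with hρ
  have hρ0 : 0 < ρ := by positivity
  have hρ1 : ρ < 1 := Real.rpow_lt_one_of_one_lt_of_neg (by norm_num) (by linarith)
  have hp1 : (1 : ℝ≥0∞) ≤ ENNReal.ofReal p := by
    rw [← ENNReal.ofReal_one]; exact ENNReal.ofReal_le_ofReal (by linarith)
  have hpiece : ∀ (J : ℕ) (a : L2 N),
      eLpNorm (fmul (lowSym s μ (J + 1)) a - fmul (lowSym s μ J) a : L2 N) (ENNReal.ofReal p)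
        volume ≤ ENNReal.ofReal (B * ρ ^ J * ‖a‖) := by
    intro J a
    rw [← fmul_sub (measurable_lowSym (J + 1)) (norm_lowSym_le hμ (J + 1)) (measurable_lowSym J)
      (norm_lowSym_le hμ J)]
    refine (eLpNorm_fmul_band_le (R := 2 ^ (J + 1)) hp (by positivity)
      ((measurable_lowSym (J + 1)).sub (measurable_lowSym J))
      (norm_lowSym_succ_sub_le hs hμ J) (fun x hx => ?_) a).trans (le_of_eq ?_)
    · rw [Pi.sub_apply, lowSym_eq_zero _ _ hx, lowSym_eq_zero _ _ (le_trans (by gcongr <;> norm_num) hx),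
        sub_zero]
    · rw [volume_real_ball (by positivity)]
      congr 2
      rw [show ((2 : ℝ) ^ (J + 1)) ^ N * κ = (2 ^ J) ^ N * (2 ^ N * κ) by ring, ← he,
        Real.mul_rpow (by positivity) (by positivity), ← hB, hρ, Real.rpow_sub two_pos (N * e) s,
        div_pow, Real.rpow_neg (by norm_num), inv_pow, ← Real.rpow_natCast_mul (by positivity),
        ← Real.rpow_natCast_mul (by positivity), ← Real.rpow_mul_natCast (by positivity)]
      field_simp
      rw [← Real.rpow_mul_natCast (by norm_num), mul_comm B]
      congr 2
      ring
  have hsum : ∀ (J K : ℕ) (a : L2 N),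
      eLpNorm (fmul (lowSym s μ (J + K)) a - fmul (lowSym s μ J) a : L2 N) (ENNReal.ofReal p)
        volume ≤ ENNReal.ofReal (B * ρ ^ J * (1 - ρ ^ K) / (1 - ρ) * ‖a‖) := by
    intro J K a
    have h1ρ : 0 < 1 - ρ := by linarith
    induction K with
    | zero =>
      simp only [add_zero, sub_self]
      rw [eLpNorm_congr_ae (Lp.coeFn_zero ℂ 2 (volume : Measure (Space N)))]
      simp
    | succ K ih =>
      have h1 : fmul (lowSym s μ (J + (K + 1))) a - fmul (lowSym s μ J) a =
        (fmul (lowSym s μ (J + K + 1)) a - fmul (lowSym s μ (J + K)) a) +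
        (fmul (lowSym s μ (J + K)) a - fmul (lowSym s μ J) a) := by rw [← add_assoc]; abel
      rw [h1, eLpNorm_congr_ae (Lp.coeFn_add _ _)]
      refine (eLpNorm_add_le (Lp.aestronglyMeasurable _) (Lp.aestronglyMeasurable _) hp1).trans
        ((add_le_add (hpiece (J + K) a) ih).trans (le_of_eq ?_))
      have : 0 ≤ 1 - ρ ^ K := by linarith [pow_le_one₀ hρ0.le hρ1.le (n := K)]
      rw [← ENNReal.ofReal_add (by positivity) (by positivity)]
      congr 1
      field_simp
      ring
  refine ⟨B / (1 - ρ), ρ, div_nonneg hB0 (by linarith), hρ0, hρ1, fun J a => ?_⟩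
  have hlim : Tendsto (fun K => fmul (lowSym s μ (J + K)) a - fmul (lowSym s μ J) a) atTop
      (𝓝 (fmul (invWt s μ) a - fmul (lowSym s μ J) a)) := by
    refine Tendsto.sub_const ?_ _
    rw [tendsto_iff_norm_sub_tendsto_zero]
    refine squeeze_zero (fun _ => norm_nonneg _) (fun K => ?_)
      (((tendsto_pow_atTop_nhds_zero_of_lt_one (by positivity)
        (two_rpow_neg_lt_one hs)).comp (tendsto_add_atTop_nat J)).mul_const ‖a‖ |>.trans_eq (by simp))
    rw [norm_sub_rev]
    simpa [add_comm] using norm_fmul_high_le hs hμ (J + K) a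
  -- The partial sums converge in `L²` only; an a.e. convergent subsequence and Fatou's lemma carry
  -- the `L^p` bound to the limit.
  obtain ⟨ns, -, hns⟩ := (tendstoInMeasure_of_tendsto_Lp hlim).exists_seq_tendsto_ae
  refine Lp.eLpNorm_le_of_ae_tendsto (u := atTop) (.of_forall fun K => ?_)
    (fun K => Lp.aestronglyMeasurable _) hns
  refine (hsum J (ns K) a).trans (ENNReal.ofReal_le_ofReal ?_)
  gcongr
  rw [div_mul_eq_mul_div]
  refine div_le_div_of_nonneg_right ?_ (by linarith)
  have h3 : 0 ≤ ρ ^ (ns K) := by positivity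
  have h4 : 0 ≤ B * ρ ^ J := by positivity
  nlinarith

theorem exists_eLpNorm_le (N : ℕ) (hs : 0 < s) (hμ : 0 < μ) (hp : 2 ≤ p)
    (hps : N * (1 / 2 - 1 / p) < s) :
    ∃ C : ℝ, 0 ≤ C ∧ ∀ a : L2 N,
      eLpNorm (fmul (invWt s μ) a) (ENNReal.ofReal p) volume ≤ ENNReal.ofReal (C * ‖a‖) := by
  obtain ⟨A, ρ, hA, hρ0, -, h⟩ := exists_eLpNorm_high_le N hs hμ hp hps
  have hp1 : (1 : ℝ≥0∞) ≤ ENNReal.ofReal p := by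
    rw [← ENNReal.ofReal_one]; exact ENNReal.ofReal_le_ofReal (by linarith)
  refine ⟨A + (Real.sqrt μ)⁻¹ * (volume.real (Metric.ball (0 : Space N) (2 ^ 0))) ^ (1 / 2 - 1 / p),
    by positivity, fun a => ?_⟩
  rw [show fmul (invWt s μ) a = (fmul (invWt s μ) a - fmul (lowSym s μ 0) a) +
    fmul (lowSym s μ 0) a by abel, eLpNorm_congr_ae (Lp.coeFn_add _ _)]
  refine (eLpNorm_add_le (Lp.aestronglyMeasurable _) (Lp.aestronglyMeasurable _) hp1).trans
    ((add_le_add (h 0 a) (eLpNorm_fmul_band_le hp (by positivity)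
      (measurable_lowSym 0) (norm_lowSym_le hμ 0) (lowSym_eq_zero 0) a)).trans (le_of_eq ?_))
  rw [← ENNReal.ofReal_add (by positivity) (by positivity), pow_zero, mul_one, add_mul]

/-- This plays the role of Lions' vanishing lemma. High frequencies are uniformly small in `L^p`, so
the low frequency part is large there; being bounded in `L²` with `p > 2`, it exceeds some fixed `δ`
at a point `y n`. After translation to the origin this is a lower bound for the pairing with a fixed
vector, which survives weak limits. -/
theorem exists_shift_weakTendsto_ne_zero (hs : 0 < s) (hμ : 0 < μ) (hp : 2 < p)
    (hps : N * (1 / 2 - 1 / p) < s) {a : ℕ → L2 N} {C c : ℝ} (hC : ∀ n, ‖a n‖ ≤ C) (hc : 0 < c)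
    (ha : ∀ n, ENNReal.ofReal c ≤ eLpNorm (fmul (invWt s μ) (a n)) (ENNReal.ofReal p) volume) :
    ∃ y : ℕ → Space N, ∃ b : L2 N, b ≠ 0 ∧ ∃ k : ℕ → ℕ, StrictMono k ∧
      WeakTendsto (fun n => shift (y (k n)) (a (k n))) b := by
  obtain ⟨A, ρ, hA, hρ0, hρ1, h⟩ := exists_eLpNorm_high_le N hs hμ hp.le hps
  have hC0 : 0 ≤ C := (norm_nonneg _).trans (hC 0)
  have hp1 : (1 : ℝ≥0∞) ≤ ENNReal.ofReal p := by
    rw [← ENNReal.ofReal_one]; exact ENNReal.ofReal_le_ofReal (by linarith)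
  have h2p : 0 < 1 - 2 / p := by rw [sub_pos, div_lt_one (by linarith)]; exact hp
  obtain ⟨J, hJ⟩ : ∃ J : ℕ, A * ρ ^ J * C < c / 2 := by
    have : Tendsto (fun J : ℕ => A * ρ ^ J * C) atTop (𝓝 (A * 0 * C)) :=
      ((tendsto_pow_atTop_nhds_zero_of_lt_one hρ0.le hρ1).const_mul A).mul_const C
    rw [mul_zero, zero_mul] at this
    exact (this.eventually_lt_const (half_pos hc)).exists
  have hlow : ∀ n, ENNReal.ofReal (c / 2) ≤
      eLpNorm (fmul (lowSym s μ J) (a n)) (ENNReal.ofReal p) volume := by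
    intro n
    by_contra! hlt
    refine (ha n).not_gt ?_
    rw [show fmul (invWt s μ) (a n) = (fmul (invWt s μ) (a n) - fmul (lowSym s μ J) (a n)) +
      fmul (lowSym s μ J) (a n) by abel, eLpNorm_congr_ae (Lp.coeFn_add _ _)]
    refine (eLpNorm_add_le (Lp.aestronglyMeasurable _) (Lp.aestronglyMeasurable _) hp1).trans_lt ?_
    rw [show c = c / 2 + c / 2 by ring, ENNReal.ofReal_add (by positivity) (by positivity)]
    have h1 := (h J (a n)).trans (ENNReal.ofReal_le_ofReal ((by gcongr; exact hC n : _ ≤ A * ρ ^ J * C).trans hJ.le))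
    exact ENNReal.add_lt_add_of_le_of_lt (ne_top_of_le_ne_top ENNReal.ofReal_ne_top h1) h1 hlt
  set D := (Real.sqrt μ)⁻¹ * C with hD
  -- By interpolation a low frequency part bounded by `δ` everywhere would have `L^p` norm below `c
  -- / 2`.
  obtain ⟨δ, hδ0, hδ⟩ : ∃ δ : ℝ, 0 < δ ∧ δ ^ (1 - 2 / p) * D ^ (2 / p) < c / 2 := by
    have : Tendsto (fun δ : ℝ => δ ^ (1 - 2 / p) * D ^ (2 / p)) (𝓝[>] 0)
        (𝓝 ((0 : ℝ) ^ (1 - 2 / p) * D ^ (2 / p))) :=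
      ((Real.continuousAt_rpow_const 0 _ (.inr h2p.le)).tendsto.mono_left
        nhdsWithin_le_nhds).mul_const _
    rw [Real.zero_rpow h2p.ne', zero_mul] at this
    obtain ⟨δ, h1, h2⟩ := ((this.eventually_lt_const (half_pos hc)).and self_mem_nhdsWithin).exists
    exact ⟨δ, h2, h1⟩
  have hy : ∀ n, ∃ y, δ < ‖inner ℂ (evalZero (lowSym s μ J)) (shift y (a n))‖ := by
    intro n
    by_contra! hle
    refine (hlow n).not_gt ((eLpNorm_le_of_bound hp.le hδ0.le _ ?_).trans_lt
      ((ENNReal.ofReal_lt_ofReal_iff (half_pos hc)).2 (lt_of_le_of_lt ?_ hδ)))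
    · filter_upwards [fmul_band_ae (measurable_lowSym J) (norm_lowSym_le hμ J) (lowSym_eq_zero J)
        (a n)] with x hx
      rw [hx]; exact hle x
    · gcongr
      exact (norm_fmul_le (measurable_lowSym J) (norm_lowSym_le hμ J) (a n)).trans
        (by rw [hD]; gcongr; exact hC n)
  choose y hy using hy
  obtain ⟨b, k, hk, hb⟩ := exists_weakTendsto_subseq (fun n => shift (y n) (a n)) C
    (fun n => by rw [norm_shift]; exact hC n)
  refine ⟨y, b, ?_, k, hk, hb⟩
  rintro rfl
  have h1 := (hb (evalZero (lowSym s μ J))).norm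
  rw [inner_zero_right, norm_zero] at h1
  have h2 := ge_of_tendsto h1 (.of_forall fun n => (hy (k n)).le)
  linarith

/-- This replaces Rellich's theorem. Low frequency parts converge pointwise with a uniform bound,
hence in `L²` of a finite measure; the remaining frequencies are uniformly small in `L²`. -/
theorem WeakTendsto.exists_subseq_ae_tendsto (hs : 0 < s) (hμ : 0 < μ) {a : ℕ → L2 N} {b : L2 N}
    (h : WeakTendsto a b) {C : ℝ} (hC : ∀ n, ‖a n‖ ≤ C) :
    ∃ k : ℕ → ℕ, StrictMono k ∧ ∀ᵐ x, Tendsto (fun n => fmul (invWt s μ) (a (k n)) x) atTop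
      (𝓝 (fmul (invWt s μ) b x)) := by
  -- The weight is integrable, positive and at most one: `ν` is finite, dominated by Lebesgue
  -- measure, and has the same null sets.
  set g : Space N → ℝ≥0∞ := fun x => ENNReal.ofReal ((1 + ‖x‖) ^ (-(N + 1 : ℝ))) with hg
  have hgm : Measurable g := by fun_prop
  set ν := (volume : Measure (Space N)).withDensity g with hν
  have hνv : ν ≤ volume := by
    have : ν ≤ volume.withDensity 1 := withDensity_mono (.of_forall fun x => by
      simp only [hg, Pi.one_apply, ENNReal.ofReal_le_one]
      exact Real.rpow_le_one_of_one_le_of_nonpos (by linarith [norm_nonneg x])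
        (by linarith [(Nat.cast_nonneg N : (0 : ℝ) ≤ N)]))
    rwa [withDensity_one] at this
  have : IsFiniteMeasure ν := by
    refine isFiniteMeasure_withDensity_ofReal ?_
    exact (integrable_one_add_norm (by rw [finrank_euclideanSpace_fin]; linarith)).2
  have hvν : volume ≪ ν := withDensity_absolutelyContinuous' hgm.aemeasurable
    (.of_forall fun x => by
      simp only [hg, ne_eq, ENNReal.ofReal_eq_zero, not_le]; positivity)
  have hC0 : 0 ≤ C := (norm_nonneg _).trans (hC 0)
  have hd : ∀ n, ‖a n - b‖ ≤ C + ‖b‖ := fun n => (norm_sub_le _ _).trans (by gcongr; exact hC n)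
  have hlow : ∀ J : ℕ, Tendsto (fun n => eLpNorm (fmul (lowSym s μ J) (a n - b)) 2 ν) atTop
      (𝓝 0) := by
    intro J
    have hae : ∀ᵐ x ∂ν, ∀ n, fmul (lowSym s μ J) (a n - b) x =
        inner ℂ (evalZero (lowSym s μ J)) (FracSP.shift x (a n - b)) :=
      ae_all_iff.2 fun n => (Measure.absolutelyContinuous_of_le hνv).ae_le
        (fmul_band_ae (measurable_lowSym J) (norm_lowSym_le hμ J) (lowSym_eq_zero J) (a n - b))
    set D := ‖evalZero (lowSym s μ J : Space N → ℂ)‖ * (C + ‖b‖)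
    have hint : Tendsto (fun n => ∫⁻ x, ‖fmul (lowSym s μ J) (a n - b) x‖ₑ ^ (2 : ℝ) ∂ν) atTop
        (𝓝 (∫⁻ _, 0 ∂ν)) := by
      refine tendsto_lintegral_of_dominated_convergence' (fun _ => ENNReal.ofReal D ^ (2 : ℝ))
        (fun n => ?_) (fun n => ?_) ?_ ?_
      · exact ((Lp.aestronglyMeasurable _).mono_measure hνv).enorm.pow_const _
      · filter_upwards [hae] with x hx
        rw [hx n, ← ofReal_norm]
        gcongr
        exact (norm_inner_evalZero_le _ x).trans
          (mul_le_mul_of_nonneg_left (hd n) (norm_nonneg _))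
      · rw [lintegral_const]
        exact ENNReal.mul_ne_top (by simp) (measure_ne_top _ _)
      · filter_upwards [hae] with x hx
        have h1 : Tendsto (fun n => fmul (lowSym s μ J) (a n - b) x) atTop (𝓝 0) := by
          refine Tendsto.congr (fun n => (hx n).symm) ?_
          simp only [map_sub, inner_sub_right]
          have := (h.shift x (evalZero (lowSym s μ J))).sub_const
            (inner ℂ (evalZero (lowSym s μ J)) (FracSP.shift x b))
          rwa [sub_self] at this
        have h2 := (ENNReal.continuous_rpow_const (y := 2)).tendsto _ |>.comp h1.enorm
        simpa [Function.comp_def] using h2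
    have h3 := (ENNReal.continuous_rpow_const (y := 1 / 2)).tendsto _ |>.comp hint
    simp only [lintegral_zero] at h3
    rw [ENNReal.zero_rpow_of_pos (by norm_num)] at h3
    refine h3.congr fun n => ?_
    rw [eLpNorm_eq_lintegral_rpow_enorm_toReal (by norm_num) (by norm_num)]
    simp
  have hfull : Tendsto (fun n => eLpNorm (fmul (invWt s μ) (a n - b)) 2 ν) atTop (𝓝 0) := by
    rw [ENNReal.tendsto_nhds_zero]
    intro ε hε
    obtain ⟨J, hJ⟩ : ∃ J : ℕ, ENNReal.ofReal (((2 : ℝ) ^ (-s)) ^ J * (C + ‖b‖)) < ε / 2 := by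
      have h1 : Tendsto (fun J : ℕ => ((2 : ℝ) ^ (-s)) ^ J * (C + ‖b‖)) atTop
          (𝓝 (0 * (C + ‖b‖))) :=
        (tendsto_pow_atTop_nhds_zero_of_lt_one (by positivity) (two_rpow_neg_lt_one hs)).mul_const _
      have h2 := ENNReal.tendsto_ofReal h1
      rw [zero_mul, ENNReal.ofReal_zero] at h2
      exact (h2.eventually_lt_const (ENNReal.half_pos hε.ne')).exists
    filter_upwards [(hlow J).eventually_lt_const (ENNReal.half_pos hε.ne')] with n hn
    rw [show fmul (invWt s μ) (a n - b) = (fmul (invWt s μ) (a n - b) -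
      fmul (lowSym s μ J) (a n - b)) + fmul (lowSym s μ J) (a n - b) by abel,
      eLpNorm_congr_ae ((Measure.absolutelyContinuous_of_le hνv).ae_le (Lp.coeFn_add _ _))]
    refine (eLpNorm_add_le ((Lp.aestronglyMeasurable _).mono_measure hνv)
      ((Lp.aestronglyMeasurable _).mono_measure hνv) (by norm_num)).trans ?_
    rw [← ENNReal.add_halves ε]
    refine add_le_add (((eLpNorm_mono_measure _ hνv).trans ?_).trans hJ.le) hn.le
    rw [← ENNReal.ofReal_toReal (Lp.eLpNorm_ne_top _), ← Lp.norm_def]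
    refine ENNReal.ofReal_le_ofReal ((norm_fmul_high_le hs hμ J _).trans ?_)
    gcongr
    exact hd n
  have hmeas : TendstoInMeasure ν (fun n => (fmul (invWt s μ) (a n) : Space N → ℂ)) atTop
      (fmul (invWt s μ) b) := by
    refine tendstoInMeasure_of_tendsto_eLpNorm (p := 2) (by norm_num)
      (fun n => (Lp.aestronglyMeasurable _).mono_measure hνv)
      ((Lp.aestronglyMeasurable _).mono_measure hνv) (hfull.congr fun n => ?_)
    refine eLpNorm_congr_ae ((Measure.absolutelyContinuous_of_le hνv).ae_le ?_)
    rw [map_sub]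
    exact Lp.coeFn_sub _ _
  obtain ⟨k, hk, hae⟩ := hmeas.exists_seq_tendsto_ae
  exact ⟨k, hk, hvν.ae_le hae⟩

end Sobolev

end FracSP

/-! ### Subcritical functions and the nonlinearity -/

namespace FracSP

variable {N : ℕ}

/-- Continuous functions that are `o(t²)` at the origin and `o(|t|^p)` at infinity. -/
structure Subcritical (g : ℝ → ℝ) (p : ℝ) : Prop where
  continuous : Continuous g
  small : ∀ η > 0, ∃ r > 0, ∀ t, |t| ≤ r → |g t| ≤ η * t ^ 2
  large : ∀ η > 0, ∃ R > 0, ∀ t, R ≤ |t| → |g t| ≤ η * |t| ^ p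

namespace Subcritical

variable {g h : ℝ → ℝ} {p : ℝ}

theorem of_abs_le (hg : Subcritical g p) (hh : Continuous h) (hle : ∀ t, |h t| ≤ |g t|) :
    Subcritical h p where
  continuous := hh
  small η hη := (hg.small η hη).imp fun _ hr => ⟨hr.1, fun t ht => (hle t).trans (hr.2 t ht)⟩
  large η hη := (hg.large η hη).imp fun _ hr => ⟨hr.1, fun t ht => (hle t).trans (hr.2 t ht)⟩

theorem map_zero (hg : Subcritical g p) : g 0 = 0 := by
  obtain ⟨r, hr, h⟩ := hg.small 1 one_pos
  simpa using h 0 (by simpa using hr.le)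

theorem exists_bound (hg : Subcritical g p) {η : ℝ} (hη : 0 < η) :
    ∃ C > 0, ∀ t, |g t| ≤ η * t ^ 2 + C * |t| ^ p := by
  obtain ⟨r, hr, h1⟩ := hg.small η hη
  obtain ⟨R, hR, h2⟩ := hg.large 1 one_pos
  have hcpt : IsCompact {t : ℝ | r ≤ |t| ∧ |t| ≤ R} := by
    refine (isCompact_Icc (a := -R) (b := R)).of_isClosed_subset ?_ fun t ht => abs_le.1 ht.2
    exact (isClosed_le continuous_const continuous_abs).inter
      (isClosed_le continuous_abs continuous_const)
  obtain ⟨B, hB⟩ := hcpt.exists_bound_of_continuousOn (f := fun t => g t / |t| ^ p) <|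
    hg.continuous.continuousOn.div (continuous_abs.continuousOn.rpow_const
      fun t ht => .inl (hr.trans_le ht.1).ne') fun t ht =>
        (Real.rpow_pos_of_pos (hr.trans_le ht.1) _).ne'
  refine ⟨max B 1, by positivity, fun t => ?_⟩
  have h0 : 0 ≤ |t| ^ p := by positivity
  rcases le_total |t| r with ht | ht
  · exact (h1 t ht).trans (le_add_of_nonneg_right (by positivity))
  refine le_trans ?_ (le_add_of_nonneg_left (by positivity))
  rcases le_total |t| R with ht' | ht'
  · have h3 := hB t ⟨ht, ht'⟩
    have h4 : 0 < |t| ^ p := Real.rpow_pos_of_pos (hr.trans_le ht) _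
    rw [norm_div, Real.norm_eq_abs, Real.norm_of_nonneg h0, div_le_iff₀ h4] at h3
    exact h3.trans (by gcongr; exact le_max_left _ _)
  · exact (h2 t ht').trans (by gcongr; exact le_max_right _ _)

/-- The pointwise inequality behind Brezis–Lieb, using continuity only. If `|b| ≥ δ|a|`, everything
is controlled by `b`. Otherwise `b` is a small relative perturbation: the growth conditions settle
small and large `a`, uniform continuity the range between. -/
theorem exists_abs_add_sub_le (hg : Subcritical g p) (hp : 0 < p) {η : ℝ} (hη : 0 < η) :
    ∃ C > 0, ∀ a b, |g (a + b) - g a| ≤ η * (a ^ 2 + |a| ^ p) + C * (b ^ 2 + |b| ^ p) := by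
  obtain ⟨C₀, hC₀, hbd⟩ := hg.exists_bound one_pos
  -- `5 = 4 + 1` comes from `(a + b)² ≤ 4a²`, and `2^p + 1` from `|a + b| ≤ 2|a|`.
  obtain ⟨r, hr, h1⟩ := hg.small (η / 5) (by positivity)
  obtain ⟨R, hR, h2⟩ := hg.large (η / (2 ^ p + 1)) (by positivity)
  have huc : UniformContinuousOn g (Set.Icc (-(4 * R)) (4 * R)) :=
    isCompact_Icc.uniformContinuousOn_of_continuous hg.continuous.continuousOn
  obtain ⟨τ, hτ, huc⟩ := Metric.uniformContinuousOn_iff.1 huc (η * (r / 2) ^ 2) (by positivity)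
  -- When `|b| < δ|a|`, this gives `|b| ≤ |a| / 2`, and `|b| < τ` as long as `|a| ≤ 2R`.
  set δ := min (1 / 2) (τ / (2 * R)) with hδ
  have hδ0 : 0 < δ := by positivity
  have hδ1 : δ ≤ 1 / 2 := min_le_left _ _
  have hδ2 : δ * (2 * R) ≤ τ := (le_div_iff₀ (by positivity)).1 (min_le_right _ _)
  refine ⟨2 * ((2 / δ) ^ 2 + C₀ * (2 / δ) ^ p), by positivity, fun a b => ?_⟩
  have ha0 : 0 ≤ |a| ^ p := by positivity
  have hb0 : 0 ≤ |b| ^ p := by positivity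
  have hsub : |g (a + b) - g a| ≤ |g (a + b)| + |g a| := abs_sub _ _
  have htri : |a + b| ≤ |a| + |b| := abs_add_le a b
  rcases le_or_gt (δ * |a|) |b| with hab | hab
  · have hcases : ∀ t, |t| ≤ 2 / δ * |b| →
        |g t| ≤ ((2 / δ) ^ 2 + C₀ * (2 / δ) ^ p) * (b ^ 2 + |b| ^ p) := by
      intro t ht
      have h3 : t ^ 2 ≤ (2 / δ) ^ 2 * b ^ 2 := by
        rw [← sq_abs t, ← sq_abs b, ← mul_pow]; gcongr
      have h4 : |t| ^ p ≤ (2 / δ) ^ p * |b| ^ p := by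
        rw [← Real.mul_rpow (by positivity) (by positivity)]; gcongr
      have h5 : 0 ≤ (2 / δ) ^ 2 * |b| ^ p := by positivity
      have h6 : 0 ≤ C₀ * (2 / δ) ^ p * b ^ 2 := by positivity
      have h7 := mul_le_mul_of_nonneg_left h4 hC₀.le
      linarith [hbd t]
    have h3 : |a| ≤ |b| / δ := by rw [le_div_iff₀ hδ0]; linarith
    have h4 : |b| ≤ |b| / δ := by
      rw [le_div_iff₀ hδ0]; nlinarith [abs_nonneg b]
    have h5 : 2 / δ * |b| = |b| / δ + |b| / δ := by ring
    have h6 : 0 ≤ η * (a ^ 2 + |a| ^ p) := by positivity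
    have h7 := hcases (a + b) (by linarith)
    have h8 := hcases a (by linarith [abs_nonneg b, div_nonneg (abs_nonneg b) hδ0.le])
    linarith
  · have hba : |b| ≤ |a| / 2 := by nlinarith [abs_nonneg a]
    refine le_trans ?_ (le_add_of_nonneg_right (by positivity))
    rcases le_total |a| (r / 2) with har | har
    · have h3 := h1 (a + b) (by linarith [abs_nonneg a])
      have h4 := h1 a (by linarith)
      have h5 : (a + b) ^ 2 ≤ 4 * a ^ 2 := by
        rw [← sq_abs (a + b), ← sq_abs a]; nlinarith [abs_nonneg (a + b), abs_nonneg a]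
      nlinarith
    rcases le_total |a| (2 * R) with haR | haR
    · have h3 := huc (a + b) (abs_le.1 (by linarith)) a (abs_le.1 (by linarith)) (by
        rw [Real.dist_eq, add_sub_cancel_left]
        nlinarith)
      rw [Real.dist_eq] at h3
      have h4 : (r / 2) ^ 2 ≤ a ^ 2 := by rw [← sq_abs a]; gcongr
      nlinarith
    · have h3 : |a| ≤ |a + b| + |b| := by
        simpa using abs_sub (a + b) b
      have h4 := h2 (a + b) (by linarith)
      have h5 := h2 a (by linarith)
      have h6 : |a + b| ^ p ≤ 2 ^ p * |a| ^ p := by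
        rw [← Real.mul_rpow (by positivity) (by positivity)]
        gcongr; linarith [abs_nonneg a]
      have h7 : η / (2 ^ p + 1) * (2 ^ p * |a| ^ p) + η / (2 ^ p + 1) * |a| ^ p = η * |a| ^ p := by
        field_simp
      have h8 : η / (2 ^ p + 1) * |a + b| ^ p ≤ η / (2 ^ p + 1) * (2 ^ p * |a| ^ p) := by gcongr
      nlinarith [sq_nonneg a]

section Integral

variable {α : Type*} [MeasurableSpace α] {m : Measure α}

theorem integrable_comp (hg : Subcritical g p) {u : α → ℝ} (hum : AEStronglyMeasurable u m)
    (h2 : Integrable (fun x => u x ^ 2) m) (hup : Integrable (fun x => |u x| ^ p) m) :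
    Integrable (fun x => g (u x)) m := by
  obtain ⟨C, -, hC⟩ := hg.exists_bound one_pos
  exact ((h2.const_mul 1).add (hup.const_mul C)).mono'
    (hg.continuous.comp_aestronglyMeasurable hum) (.of_forall fun x => hC (u x))

/-- The Brezis–Lieb lemma. -/
theorem tendsto_integral_sub (hg : Subcritical g p) (hp : 0 < p) {v : ℕ → α → ℝ} {w : α → ℝ}
    (hvm : ∀ n, AEStronglyMeasurable (v n) m) (hv2 : ∀ n, Integrable (fun x => v n x ^ 2) m)
    (hvp : ∀ n, Integrable (fun x => |v n x| ^ p) m) (hwm : AEStronglyMeasurable w m)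
    (hw2 : Integrable (fun x => w x ^ 2) m) (hwp : Integrable (fun x => |w x| ^ p) m)
    {M : ℝ} (hM : ∀ n, ∫ x, (v n x ^ 2 + |v n x| ^ p) ∂m ≤ M)
    (hv : ∀ᵐ x ∂m, Tendsto (fun n => v n x) atTop (𝓝 0)) :
    Tendsto (fun n => ∫ x, (g (v n x + w x) - g (v n x) - g (w x)) ∂m) atTop (𝓝 0) := by
  have hΦv : ∀ n, Integrable (fun x => v n x ^ 2 + |v n x| ^ p) m := fun n => (hv2 n).add (hvp n)
  have hΦw : Integrable (fun x => w x ^ 2 + |w x| ^ p) m := hw2.add hwp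
  have hM0 : 0 ≤ M := (integral_nonneg fun x => by positivity).trans (hM 0)
  obtain ⟨C₀, hC₀, hbd⟩ := hg.exists_bound one_pos
  set d : ℕ → α → ℝ := fun n x => |g (v n x + w x) - g (v n x) - g (w x)| with hd
  have hgc := hg.continuous
  have hdm : ∀ n, AEStronglyMeasurable (d n) m := fun n => by
    refine Continuous.comp_aestronglyMeasurable continuous_abs (AEStronglyMeasurable.sub
      (AEStronglyMeasurable.sub ?_ ?_) ?_)
    · exact hgc.comp_aestronglyMeasurable ((hvm n).add hwm)
    · exact hgc.comp_aestronglyMeasurable (hvm n)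
    · exact hgc.comp_aestronglyMeasurable hwm
  have hbound : ∀ η > 0, ∃ C > 0, ∀ n x, d n x ≤
      η * (v n x ^ 2 + |v n x| ^ p) + C * (w x ^ 2 + |w x| ^ p) := by
    intro η hη
    obtain ⟨C, hC, h⟩ := hg.exists_abs_add_sub_le hp hη
    refine ⟨C + (1 + C₀), by positivity, fun n x => ?_⟩
    have h1 : d n x ≤ |g (v n x + w x) - g (v n x)| + |g (w x)| := abs_sub _ _
    have h2 := h (v n x) (w x)
    have h3 := hbd (w x)
    have h4 : 0 ≤ |w x| ^ p := by positivity
    nlinarith [sq_nonneg (w x)]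
  have hdint : ∀ n, Integrable (d n) m := fun n => by
    obtain ⟨C, -, h⟩ := hbound 1 one_pos
    refine (((hΦv n).const_mul 1).add (hΦw.const_mul C)).mono' (hdm n) (.of_forall fun x => ?_)
    rw [Real.norm_of_nonneg (abs_nonneg _)]
    exact h n x
  have hd0 : Tendsto (fun n => ∫ x, d n x ∂m) atTop (𝓝 0) := by
    refine tendsto_order.2 ⟨fun a ha => .of_forall fun n =>
      ha.trans_le (integral_nonneg fun x => abs_nonneg _), fun a ha => ?_⟩
    obtain ⟨η, hη, hηM⟩ : ∃ η > 0, η * M < a / 2 := by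
      refine ⟨a / (4 * (M + 1)), by positivity, ?_⟩
      rw [div_mul_eq_mul_div, div_lt_div_iff₀ (by positivity) (by positivity)]
      nlinarith
    obtain ⟨C, hC, h⟩ := hbound η hη
    -- The part of `d n` above `η(v² + |v|^p)` is dominated by a fixed integrable function, so it
    -- vanishes in the limit; the part below integrates to at most `ηM`.
    have heint : ∀ n, Integrable (fun x => max (d n x - η * (v n x ^ 2 + |v n x| ^ p)) 0) m :=
      fun n => ((hdint n).sub ((hΦv n).const_mul η)).sup (integrable_zero _ _ _)
    have he : Tendsto (fun n => ∫ x, max (d n x - η * (v n x ^ 2 + |v n x| ^ p)) 0 ∂m) atTop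
        (𝓝 (∫ _, (0 : ℝ) ∂m)) := by
      refine tendsto_integral_of_dominated_convergence (fun x => C * (w x ^ 2 + |w x| ^ p))
        (fun n => ?_) (hΦw.const_mul C) (fun n => .of_forall fun x => ?_) ?_
      · exact (heint n).aestronglyMeasurable
      · rw [Real.norm_of_nonneg (le_max_right _ _)]
        exact max_le (by linarith [h n x]) (by positivity)
      · filter_upwards [hv] with x hx
        have h1 : Tendsto (fun n => d n x - η * (v n x ^ 2 + |v n x| ^ p)) atTop
            (𝓝 (|g (0 + w x) - g 0 - g (w x)| - η * (0 ^ 2 + |0| ^ p))) := by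
          refine Tendsto.sub (Tendsto.abs (((((hgc.tendsto _).comp (hx.add_const _)).sub
            ((hgc.tendsto _).comp hx)).sub_const _))) (((hx.pow 2).add ?_).const_mul η)
          exact ((Real.continuous_rpow_const hp.le).tendsto _).comp hx.abs
        have h2 := h1.max (tendsto_const_nhds (x := (0 : ℝ)))
        simpa [hg.map_zero, Real.zero_rpow hp.ne'] using h2
    rw [integral_zero] at he
    filter_upwards [he.eventually_lt_const (half_pos ha)] with n hn
    have h1 : ∫ x, d n x ∂m ≤ ∫ x, (max (d n x - η * (v n x ^ 2 + |v n x| ^ p)) 0 +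
        η * (v n x ^ 2 + |v n x| ^ p)) ∂m := by
      refine integral_mono (hdint n) ((heint n).add ((hΦv n).const_mul η)) fun x => ?_
      have := le_max_left (d n x - η * (v n x ^ 2 + |v n x| ^ p)) 0
      simp only
      linarith
    rw [integral_add (heint n) ((hΦv n).const_mul η), integral_const_mul] at h1
    have h2 := mul_le_mul_of_nonneg_left (hM n) hη.le
    linarith
  exact squeeze_zero_norm (fun n => norm_integral_le_integral_norm _) hd0

end Integral

end Subcritical

/-- The hypotheses on the nonlinearity, with critical growth exponent below `p`. -/
structure IsNonlinearity (f : ℝ → ℝ) (p : ℝ) : Prop where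
  continuous : Continuous f
  eq_zero : ∀ t ≤ 0, f t = 0
  tendsto_zero : Tendsto (fun t => f t / t) (𝓝[≠] 0) (𝓝 0)
  tendsto_atTop : Tendsto (fun t => f t / t ^ (p - 1)) atTop (𝓝 0)
  primitive_pos : ∀ t > 0, 0 < primitive f t
  primitive_le : ∀ t > 0, 4 * primitive f t ≤ f t * t
  strictMono : StrictMonoOn (fun t => f t / t ^ 3) (Set.Ioi 0)

/-- `H(t) = f(t) t / 4 - F(t)`. -/
def excess (f : ℝ → ℝ) (t : ℝ) : ℝ := f t * t / 4 - primitive f t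

namespace IsNonlinearity

variable {f : ℝ → ℝ} {p : ℝ}

theorem primitive_of_nonpos (hf : IsNonlinearity f p) {t : ℝ} (ht : t ≤ 0) :
    primitive f t = 0 := by
  rw [primitive, intervalIntegral.integral_congr (g := fun _ => 0), intervalIntegral.integral_zero]
  intro x hx
  rw [Set.uIcc_of_ge ht] at hx
  exact hf.eq_zero x hx.2

theorem primitive_nonneg (hf : IsNonlinearity f p) (t : ℝ) : 0 ≤ primitive f t := by
  rcases le_or_gt t 0 with ht | ht
  · rw [hf.primitive_of_nonpos ht]
  · exact (hf.primitive_pos t ht).le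

theorem four_mul_primitive_le (hf : IsNonlinearity f p) (t : ℝ) :
    4 * primitive f t ≤ f t * t := by
  rcases le_or_gt t 0 with ht | ht
  · rw [hf.primitive_of_nonpos ht, hf.eq_zero t ht]; simp
  · exact hf.primitive_le t ht

theorem mul_self_nonneg (hf : IsNonlinearity f p) (t : ℝ) : 0 ≤ f t * t := by
  linarith [hf.primitive_nonneg t, hf.four_mul_primitive_le t]

theorem excess_nonneg (hf : IsNonlinearity f p) (t : ℝ) : 0 ≤ excess f t := by
  rw [excess]; linarith [hf.four_mul_primitive_le t]

theorem continuous_primitive (hf : IsNonlinearity f p) : Continuous (primitive f) :=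
  intervalIntegral.continuous_primitive (fun a b => hf.continuous.intervalIntegrable a b) 0

/-- Put `a = tu` and `c = f(u)/u³`. On `[a, u]` monotonicity gives `f(τ) ≤ cτ³`; using this at `τ =
a` and integrated over `[a, u]`, the quartic terms of `H(u) - H(a)` cancel. -/
theorem excess_mul_le (hf : IsNonlinearity f p) {t : ℝ} (ht0 : 0 < t) (ht1 : t ≤ 1) (u : ℝ) :
    excess f (t * u) ≤ excess f u := by
  rcases le_or_gt u 0 with hu | hu
  · have h : t * u ≤ 0 := mul_nonpos_of_nonneg_of_nonpos ht0.le hu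
    rw [excess, excess, hf.eq_zero _ h, hf.primitive_of_nonpos h, hf.eq_zero _ hu,
      hf.primitive_of_nonpos hu]
    simp
  set a := t * u with ha
  have ha0 : 0 < a := mul_pos ht0 hu
  have hau : a ≤ u := by rw [ha]; nlinarith
  have hmono : ∀ x y, 0 < x → x ≤ y → f x ≤ x ^ 3 * (f y / y ^ 3) := by
    intro x y hx hxy
    have := hf.strictMono.monotoneOn (Set.mem_Ioi.2 hx) (Set.mem_Ioi.2 (hx.trans_le hxy)) hxy
    rw [div_le_iff₀ (by positivity)] at this
    linarith
  have h1 : primitive f u - primitive f a = ∫ τ in a..u, f τ := by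
    rw [primitive, primitive, intervalIntegral.integral_interval_sub_left]
    · exact hf.continuous.intervalIntegrable _ _
    · exact hf.continuous.intervalIntegrable _ _
  have h2 : ∫ τ in a..u, f τ ≤ ∫ τ in a..u, τ ^ 3 * (f u / u ^ 3) := by
    refine intervalIntegral.integral_mono_on hau (hf.continuous.intervalIntegrable _ _)
      (Continuous.intervalIntegrable (by fun_prop) _ _) fun x hx => ?_
    exact hmono x u (ha0.trans_le hx.1) hx.2
  rw [intervalIntegral.integral_mul_const, integral_pow] at h2
  have h3 := hmono a u ha0 hau
  have h4 : (u ^ 4 - a ^ 4) / 4 * (f u / u ^ 3) = f u * u / 4 - a * (a ^ 3 * (f u / u ^ 3)) / 4 := by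
    field_simp
  norm_num at h2
  rw [excess, excess]
  nlinarith

theorem subcritical_mul_self (hf : IsNonlinearity f p) : Subcritical (fun t => f t * t) p where
  continuous := hf.continuous.mul continuous_id
  small η hη := by
    have h := (hf.tendsto_zero.eventually (Metric.ball_mem_nhds 0 hη))
    rw [eventually_nhdsWithin_iff, Metric.eventually_nhds_iff] at h
    obtain ⟨r, hr, h⟩ := h
    refine ⟨r / 2, by positivity, fun t ht => ?_⟩
    by_cases h0 : t = 0
    · simp [h0]
    have h1 := h (y := t) (by rw [Real.dist_eq, sub_zero]; linarith) h0
    rw [Real.dist_eq, sub_zero, abs_div, div_lt_iff₀ (abs_pos.2 h0)] at h1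
    rw [abs_mul, ← sq_abs t]
    nlinarith [abs_nonneg t]
  large η hη := by
    obtain ⟨R, hR⟩ := eventually_atTop.1 (hf.tendsto_atTop.eventually (Metric.ball_mem_nhds 0 hη))
    refine ⟨max R 1, by positivity, fun t ht => ?_⟩
    rcases le_or_gt t 0 with h0 | h0
    · rw [hf.eq_zero t h0, zero_mul, abs_zero]; positivity
    rw [abs_of_pos h0] at ht ⊢
    have h1 := hR t ((le_max_left _ _).trans ht)
    rw [Real.dist_eq, sub_zero, abs_div, abs_of_pos (Real.rpow_pos_of_pos h0 _),
      div_lt_iff₀ (Real.rpow_pos_of_pos h0 _)] at h1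
    rw [abs_mul, abs_of_pos h0]
    calc |f t| * t ≤ η * t ^ (p - 1) * t := by gcongr
      _ = η * t ^ p := by rw [mul_assoc, ← Real.rpow_add_one h0.ne', sub_add_cancel]

theorem subcritical_primitive (hf : IsNonlinearity f p) : Subcritical (primitive f) p :=
  hf.subcritical_mul_self.of_abs_le hf.continuous_primitive fun t => by
    rw [abs_of_nonneg (hf.primitive_nonneg t), abs_of_nonneg (hf.mul_self_nonneg t)]
    linarith [hf.primitive_nonneg t, hf.four_mul_primitive_le t]

theorem subcritical_excess (hf : IsNonlinearity f p) : Subcritical (excess f) p := by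
  refine hf.subcritical_mul_self.of_abs_le ?_ fun t => ?_
  · exact ((hf.continuous.mul continuous_id).div_const 4).sub hf.continuous_primitive
  · rw [abs_of_nonneg (hf.excess_nonneg t), abs_of_nonneg (hf.mul_self_nonneg t), excess]
    linarith [hf.primitive_nonneg t, hf.mul_self_nonneg t]

end IsNonlinearity

end FracSP

/-! ### The limit problem -/

namespace FracSP

variable {N : ℕ} {s μ p : ℝ} {f : ℝ → ℝ}

theorem Rep.integrable_sq {u : Space N → ℝ} {a : L2 N} (h : Rep s μ u a) :
    Integrable (fun x => u x ^ 2) := h.memLp.integrable_sq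

theorem Rep.eLpNorm_eq {u : Space N → ℝ} {a : L2 N} (h : Rep s μ u a) (q : ℝ≥0∞) :
    eLpNorm (fmul (invWt s μ) a) q volume = eLpNorm u q volume := by
  rw [eLpNorm_congr_ae h]
  exact eLpNorm_congr_norm_ae (.of_forall fun x => Complex.norm_real _)

theorem eLpNorm_ofReal_eq {u : Space N → ℝ} (hp : 0 < p) (hu : MemLp u (ENNReal.ofReal p) volume) :
    eLpNorm u (ENNReal.ofReal p) volume = ENNReal.ofReal ((∫ x, |u x| ^ p) ^ (1 / p)) := by
  rw [hu.eLpNorm_eq_integral_rpow_norm (by simpa using hp) ENNReal.ofReal_ne_top,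
    ENNReal.toReal_ofReal hp.le, one_div]
  rfl

/-- The subcritical Sobolev inequality. -/
theorem exists_integral_rpow_le (N : ℕ) (hs : 0 < s) (hμ : 0 < μ) (hp : 2 ≤ p)
    (hps : N * (1 / 2 - 1 / p) < s) :
    ∃ S > 0, ∀ (u : Space N → ℝ) (a : L2 N), Rep s μ u a →
      MemLp u (ENNReal.ofReal p) volume ∧ Integrable (fun x => |u x| ^ p) ∧
        ∫ x, |u x| ^ p ≤ S * ‖a‖ ^ p := by
  have hp0 : 0 < p := by linarith
  obtain ⟨C, hC, h⟩ := exists_eLpNorm_le N hs hμ hp hps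
  refine ⟨(C + 1) ^ p, by positivity, fun u a hu => ?_⟩
  have h1 := h a
  rw [hu.eLpNorm_eq] at h1
  have hm : MemLp u (ENNReal.ofReal p) volume :=
    ⟨hu.memLp.aestronglyMeasurable, h1.trans_lt ENNReal.ofReal_lt_top⟩
  refine ⟨hm, ?_, ?_⟩
  · have := hm.integrable_norm_rpow (by simpa using hp0) ENNReal.ofReal_ne_top
    rwa [ENNReal.toReal_ofReal hp0.le] at this
  · rw [eLpNorm_ofReal_eq hp0 hm, ENNReal.ofReal_le_ofReal_iff (by positivity)] at h1
    have h0 : 0 ≤ ∫ x, |u x| ^ p := integral_nonneg fun x => by positivity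
    calc ∫ x, |u x| ^ p = ((∫ x, |u x| ^ p) ^ (1 / p)) ^ p := by
          rw [← Real.rpow_mul h0, one_div_mul_cancel hp0.ne', Real.rpow_one]
      _ ≤ ((C + 1) * ‖a‖) ^ p := by
          gcongr; exact h1.trans (by gcongr; linarith)
      _ = _ := Real.mul_rpow (by positivity) (norm_nonneg _)

theorem Subcritical.integrable_rep {g : ℝ → ℝ} (hg : Subcritical g p) (hs : 0 < s) (hμ : 0 < μ)
    (hp : 2 ≤ p) (hps : N * (1 / 2 - 1 / p) < s) {u : Space N → ℝ} {a : L2 N}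
    (hu : Rep s μ u a) : Integrable (fun x => g (u x)) := by
  obtain ⟨S, -, h⟩ := exists_integral_rpow_le N hs hμ hp hps
  exact hg.integrable_comp hu.memLp.aestronglyMeasurable hu.integrable_sq (h u a hu).2.1

theorem exists_integral_mul_self_le (hf : IsNonlinearity f p) (N : ℕ) (hs : 0 < s) (hμ : 0 < μ)
    (hp : 2 ≤ p) (hps : N * (1 / 2 - 1 / p) < s) :
    ∃ C > 0, ∀ (u : Space N → ℝ) (a : L2 N), Rep s μ u a →
      ∫ x, f (u x) * u x ≤ 1 / 2 * ‖a‖ ^ 2 + C * ∫ x, |u x| ^ p := by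
  obtain ⟨S, -, h⟩ := exists_integral_rpow_le N hs hμ hp hps
  -- The coefficient `μ / 2` lets half of `‖a‖²` absorb the quadratic part.
  obtain ⟨C, hC, hbd⟩ := hf.subcritical_mul_self.exists_bound (half_pos hμ)
  refine ⟨C, hC, fun u a hu => ?_⟩
  have h1 : ∫ x, f (u x) * u x ≤ ∫ x, (μ / 2 * u x ^ 2 + C * |u x| ^ p) :=
    integral_mono (hf.subcritical_mul_self.integrable_rep hs hμ hp hps hu)
      ((hu.integrable_sq.const_mul _).add ((h u a hu).2.1.const_mul _))
      fun x => (le_abs_self _).trans (hbd (u x))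
  rw [integral_add (hu.integrable_sq.const_mul _) ((h u a hu).2.1.const_mul _),
    integral_const_mul, integral_const_mul] at h1
  have h2 := hu.integral_sq_le hμ
  linarith

/-- Absorption gives `‖a‖² ≤ 2C∫|u|^p ≤ 2CS‖a‖^p`. As `p > 2`, this bounds `‖a‖` from below, and the
first inequality then bounds the `L^p` norm from below. -/
theorem exists_le_eLpNorm (hf : IsNonlinearity f p) (N : ℕ) (hs : 0 < s) (hμ : 0 < μ)
    (hp : 2 < p) (hps : N * (1 / 2 - 1 / p) < s) :
    ∃ c > 0, ∀ (u : Space N → ℝ) (a : L2 N), Rep s μ u a → a ≠ 0 →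
      ‖a‖ ^ 2 ≤ ∫ x, f (u x) * u x →
      ENNReal.ofReal c ≤ eLpNorm (fmul (invWt s μ) a) (ENNReal.ofReal p) volume := by
  have hp0 : 0 < p := by linarith
  obtain ⟨S, hS, h⟩ := exists_integral_rpow_le N hs hμ hp.le hps
  obtain ⟨C, hC, hb⟩ := exists_integral_mul_self_le hf N hs hμ hp.le hps
  refine ⟨(((2 * C * S)⁻¹ ^ (1 / (p - 2))) ^ 2 / (2 * C)) ^ (1 / p), by positivity,
    fun u a hu ha hJ => ?_⟩
  obtain ⟨hm, -, hle⟩ := h u a hu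
  rw [hu.eLpNorm_eq, eLpNorm_ofReal_eq hp0 hm]
  have ha0 : 0 < ‖a‖ := norm_pos_iff.2 ha
  have h1 : ‖a‖ ^ 2 ≤ 2 * C * ∫ x, |u x| ^ p := by linarith [hb u a hu]
  have h2 : ‖a‖ ^ p = ‖a‖ ^ 2 * ‖a‖ ^ (p - 2) := by
    rw [← Real.rpow_natCast, ← Real.rpow_add ha0]; norm_num
  have h3 : (2 * C * S)⁻¹ ≤ ‖a‖ ^ (p - 2) := by
    rw [inv_le_iff_one_le_mul₀ (by positivity)]
    have h4 : ‖a‖ ^ 2 * 1 ≤ ‖a‖ ^ 2 * (‖a‖ ^ (p - 2) * (2 * C * S)) := by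
      calc ‖a‖ ^ 2 * 1 ≤ 2 * C * (S * ‖a‖ ^ p) := by
            rw [mul_one]; exact h1.trans (by gcongr)
        _ = _ := by rw [h2]; ring
    exact le_of_mul_le_mul_left h4 (by positivity)
  have h5 : (2 * C * S)⁻¹ ^ (1 / (p - 2)) ≤ ‖a‖ := by
    calc (2 * C * S)⁻¹ ^ (1 / (p - 2)) ≤ (‖a‖ ^ (p - 2)) ^ (1 / (p - 2)) := by
          gcongr
      _ = ‖a‖ := by
          rw [← Real.rpow_mul ha0.le, mul_one_div_cancel (by linarith), Real.rpow_one]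
  refine ENNReal.ofReal_le_ofReal (Real.rpow_le_rpow (by positivity) ?_ (by positivity))
  rw [div_le_iff₀ (by positivity)]
  calc ((2 * C * S)⁻¹ ^ (1 / (p - 2))) ^ 2 ≤ ‖a‖ ^ 2 := by gcongr
    _ ≤ _ := by linarith

/-- Projection onto the Nehari manifold along rays. -/
theorem exists_mul_mem_nehariM (hf : IsNonlinearity f p) (hs : 0 < s) (hμ : 0 < μ)
    (hp : 2 < p) (hps : N * (1 / 2 - 1 / p) < s) {u : Space N → ℝ} {a : L2 N}
    (hu : Rep s μ u a) (ha : a ≠ 0) (hJ : ‖a‖ ^ 2 ≤ ∫ x, f (u x) * u x) :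
    ∃ t, 0 < t ∧ t ≤ 1 ∧ (fun x => t * u x) ∈ nehariM N s f μ := by
  have hp0 : 0 < p := by linarith
  obtain ⟨S, hS, h⟩ := exists_integral_rpow_le N hs hμ hp.le hps
  obtain ⟨C, hC, hb⟩ := exists_integral_mul_self_le hf N hs hμ hp.le hps
  have ha0 : 0 < ‖a‖ := norm_pos_iff.2 ha
  have hG := hf.subcritical_mul_self
  -- A zero of `ψ` is a point of the Nehari manifold. `ψ 1 ≤ 0` by hypothesis, while `ψ ≥ 0` at some
  -- small `t`, the superquadratic part being of order `t^p`.
  set ψ : ℝ → ℝ := fun t => t ^ 2 * ‖a‖ ^ 2 - ∫ x, f (t * u x) * (t * u x) with hψ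
  have hcont : ContinuousOn ψ (Set.Icc 0 1) := by
    refine ContinuousOn.sub (by fun_prop) ?_
    obtain ⟨C₁, hC₁, hbd⟩ := hG.exists_bound one_pos
    refine continuousOn_of_dominated (bound := fun x => 1 * u x ^ 2 + C₁ * |u x| ^ p)
      (fun t _ => ?_) (fun t ht => .of_forall fun x => ?_)
      ((hu.integrable_sq.const_mul 1).add ((h u a hu).2.1.const_mul C₁))
      (.of_forall fun x => ?_)
    · exact hG.continuous.comp_aestronglyMeasurable (hu.memLp.aestronglyMeasurable.const_mul t)
    · refine (hbd (t * u x)).trans ?_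
      have h1 : |t * u x| ≤ |u x| := by
        rw [abs_mul, abs_of_nonneg ht.1]
        exact mul_le_of_le_one_left (abs_nonneg _) ht.2
      have h2 : (t * u x) ^ 2 ≤ u x ^ 2 := sq_le_sq.2 h1
      gcongr
    · have := hf.continuous
      fun_prop
  obtain ⟨t₀, ht₀, ht₁, hpos⟩ : ∃ t₀, 0 < t₀ ∧ t₀ ≤ 1 ∧ 0 ≤ ψ t₀ := by
    have hlim : Tendsto (fun t : ℝ => C * (S * (t ^ (p - 2) * ‖a‖ ^ p))) (𝓝[>] 0)
        (𝓝 (C * (S * ((0 : ℝ) ^ (p - 2) * ‖a‖ ^ p)))) :=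
      ((((Real.continuousAt_rpow_const 0 _ (.inr (by linarith))).tendsto.mono_left
        nhdsWithin_le_nhds).mul_const _).const_mul S).const_mul C
    rw [Real.zero_rpow (by linarith), zero_mul, mul_zero, mul_zero] at hlim
    obtain ⟨t, ht, hts⟩ := ((hlim.eventually_lt_const (u := ‖a‖ ^ 2 / 2) (by positivity)).and
      (Ioc_mem_nhdsGT zero_lt_one)).exists
    refine ⟨t, hts.1, hts.2, ?_⟩
    have h1 := hb _ _ (hu.smul t)
    have h2 := (h _ _ (hu.smul t)).2.2
    have h3 : ‖(t : ℂ) • a‖ = t * ‖a‖ := by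
      rw [norm_smul, Complex.norm_real, Real.norm_of_nonneg hts.1.le]
    have h4 : (t * ‖a‖) ^ p = t ^ 2 * (t ^ (p - 2) * ‖a‖ ^ p) := by
      rw [Real.mul_rpow hts.1.le ha0.le, ← mul_assoc]
      congr 1
      rw [← Real.rpow_natCast, ← Real.rpow_add hts.1]; norm_num
    rw [h3] at h1 h2
    rw [h4] at h2
    have h5 : C * ∫ x, |t * u x| ^ p ≤ t ^ 2 * (‖a‖ ^ 2 / 2) := by
      calc C * ∫ x, |t * u x| ^ p ≤ C * (S * (t ^ 2 * (t ^ (p - 2) * ‖a‖ ^ p))) := by gcongr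
        _ = t ^ 2 * (C * (S * (t ^ (p - 2) * ‖a‖ ^ p))) := by ring
        _ ≤ _ := by gcongr
    simp only [hψ]
    linarith
  obtain ⟨t, ht, hzero⟩ := intermediate_value_Icc' ht₁
    (hcont.mono (Set.Icc_subset_Icc_left ht₀.le))
    (show (0 : ℝ) ∈ Set.Icc (ψ 1) (ψ t₀) from ⟨by simpa [hψ] using hJ, hpos⟩)
  have ht0 : 0 < t := ht₀.trans_le ht.1
  have hrep := hu.smul t
  refine ⟨t, ht0, ht.2, hrep.memHs hμ, fun h0 => ?_, ?_⟩
  · have := hrep.eq_zero_of_ae hμ h0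
    simp [ha, ht0.ne'] at this
  · rw [hrep.norm_sq hμ, norm_smul, Complex.norm_real, Real.norm_of_nonneg ht0.le, mul_pow]
    exact sub_eq_zero.1 hzero

theorem integral_excess (hf : IsNonlinearity f p) (hs : 0 < s) (hμ : 0 < μ) (hp : 2 ≤ p)
    (hps : N * (1 / 2 - 1 / p) < s) {u : Space N → ℝ} {a : L2 N} (hu : Rep s μ u a) :
    ∫ x, excess f (u x) = (∫ x, f (u x) * u x) / 4 - ∫ x, primitive f (u x) := by
  simp only [excess]
  rw [integral_sub ((hf.subcritical_mul_self.integrable_rep hs hμ hp hps hu).div_const 4)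
    (hf.subcritical_primitive.integrable_rep hs hμ hp hps hu), integral_div]

theorem energyE_eq (hf : IsNonlinearity f p) (hs : 0 < s) (hμ : 0 < μ) (hp : 2 ≤ p)
    (hps : N * (1 / 2 - 1 / p) < s) {u : Space N → ℝ} (hu : u ∈ nehariM N s f μ) {a : L2 N}
    (ha : Rep s μ u a) : energyE s f μ u = 1 / 4 * ‖a‖ ^ 2 + ∫ x, excess f (u x) := by
  have h1 := hu.2.2
  have h2 := ha.norm_sq hμ
  rw [integral_excess hf hs hμ hp hps ha, energyE]
  linarith

/-- Projecting to the Nehari manifold uses a factor `t ≤ 1`, which increases neither the norm nor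
the integral of `excess`. -/
theorem groundLevel_le (hf : IsNonlinearity f p) (hs : 0 < s) (hμ : 0 < μ)
    (hp : 2 < p) (hps : N * (1 / 2 - 1 / p) < s) {u : Space N → ℝ} {a : L2 N}
    (hu : Rep s μ u a) (ha : a ≠ 0) (hJ : ‖a‖ ^ 2 ≤ ∫ x, f (u x) * u x) :
    groundLevel N s f μ ≤ 1 / 4 * ‖a‖ ^ 2 + ∫ x, excess f (u x) := by
  obtain ⟨t, ht0, ht1, ht⟩ := exists_mul_mem_nehariM hf hs hμ hp hps hu ha hJ
  -- `sInf` bounds the elements of a real set from below only once the set is known to be bounded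
  -- below.
  have hbdd : BddBelow (energyE s f μ '' nehariM N s f μ) := by
    refine ⟨0, ?_⟩
    rintro _ ⟨w, hw, rfl⟩
    obtain ⟨b, hb⟩ := hw.1.exists_rep hμ
    rw [energyE_eq hf hs hμ hp.le hps hw hb]
    exact add_nonneg (by positivity) (integral_nonneg fun x => hf.excess_nonneg (w x))
  refine (csInf_le hbdd ⟨_, ht, rfl⟩).trans ?_
  rw [energyE_eq hf hs hμ hp.le hps ht (hu.smul t), norm_smul, Complex.norm_real,
    Real.norm_of_nonneg ht0.le]
  have hH := hf.subcritical_excess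
  refine add_le_add ?_ (integral_mono (hH.integrable_rep hs hμ hp.le hps (hu.smul t))
    (hH.integrable_rep hs hμ hp.le hps hu) fun x => hf.excess_mul_le ht0 ht1 (u x))
  gcongr
  exact mul_le_of_le_one_left (norm_nonneg _) ht1

theorem WeakTendsto.norm_sub_sq {a : ℕ → L2 N} {b : L2 N} (h : WeakTendsto a b) :
    Tendsto (fun n => ‖a n - b‖ ^ 2 - ‖a n‖ ^ 2) atTop (𝓝 (-‖b‖ ^ 2)) := by
  have h1 := (Complex.continuous_re.tendsto _).comp (h b)
  have h2 : Complex.re (inner ℂ b b) = ‖b‖ ^ 2 := inner_self_eq_norm_sq (𝕜 := ℂ) b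
  rw [h2] at h1
  have h3 := (h1.const_mul (-2)).add_const (‖b‖ ^ 2)
  rw [show -2 * ‖b‖ ^ 2 + ‖b‖ ^ 2 = -‖b‖ ^ 2 by ring] at h3
  refine h3.congr fun n => ?_
  have h4 := _root_.norm_sub_sq (𝕜 := ℂ) (a n) b
  have h5 : RCLike.re (inner ℂ (a n) b) = Complex.re (inner ℂ b (a n)) :=
    inner_re_symm (𝕜 := ℂ) _ _
  rw [h4, h5, Function.comp_apply]
  ring

/-- The Fourier side is a complex space; that the weak limit still represents a real function
follows from a.e. convergence, the imaginary parts being zero. -/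
theorem Rep.of_ae_tendsto {u : ℕ → Space N → ℝ} {a : ℕ → L2 N} {b : L2 N}
    (hu : ∀ n, Rep s μ (u n) (a n))
    (h : ∀ᵐ x, Tendsto (fun n => fmul (invWt s μ) (a n) x) atTop (𝓝 (fmul (invWt s μ) b x))) :
    ∃ v, Rep s μ v b ∧ ∀ᵐ x, Tendsto (fun n => u n x) atTop (𝓝 (v x)) := by
  have hre : ∀ᵐ x, Tendsto (fun n => (u n x : ℂ)) atTop (𝓝 (fmul (invWt s μ) b x)) := by
    filter_upwards [h, ae_all_iff.2 hu] with x h1 h2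
    exact h1.congr h2
  refine ⟨fun x => (fmul (invWt s μ) b x).re, ?_, ?_⟩
  · rw [Rep]
    filter_upwards [hre] with x hx
    have h1 := (Complex.continuous_im.tendsto _).comp hx
    have h2 : (0 : ℝ) = (fmul (invWt s μ) b x).im :=
      tendsto_nhds_unique (tendsto_const_nhds.congr fun n => by simp) h1
    exact Complex.ext rfl (by simp [← h2])
  · filter_upwards [hre] with x hx
    simpa [Function.comp_def] using (Complex.continuous_re.tendsto _).comp hx

theorem Subcritical.tendsto_integral_rep_sub {g : ℝ → ℝ} (hg : Subcritical g p) (hs : 0 < s)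
    (hμ : 0 < μ) (hp : 2 ≤ p) (hps : N * (1 / 2 - 1 / p) < s) {u : ℕ → Space N → ℝ}
    {v : Space N → ℝ} {a : ℕ → L2 N} {b : L2 N} (hu : ∀ n, Rep s μ (u n) (a n))
    (hv : Rep s μ v b) {C : ℝ} (hC : ∀ n, ‖a n‖ ≤ C)
    (h : ∀ᵐ x, Tendsto (fun n => u n x) atTop (𝓝 (v x))) :
    Tendsto (fun n => (∫ x, g (u n x)) - ∫ x, g ((u n - v) x)) atTop (𝓝 (∫ x, g (v x))) := by
  have hp0 : 0 < p := by linarith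
  obtain ⟨S, hS, hSob⟩ := exists_integral_rpow_le N hs hμ hp hps
  have hd : ∀ n, Rep s μ (u n - v) (a n - b) := fun n => (hu n).sub hv
  have hdn : ∀ n, ‖a n - b‖ ≤ C + ‖b‖ := fun n => (norm_sub_le _ _).trans (by gcongr; exact hC n)
  have hBL := hg.tendsto_integral_sub hp0 (fun n => (hd n).memLp.aestronglyMeasurable)
    (fun n => (hd n).integrable_sq) (fun n => (hSob _ _ (hd n)).2.1)
    hv.memLp.aestronglyMeasurable hv.integrable_sq (hSob _ _ hv).2.1
    (M := μ⁻¹ * (C + ‖b‖) ^ 2 + S * (C + ‖b‖) ^ p) (fun n => ?_) ?_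
  · have h2 := hBL.add_const (∫ x, g (v x))
    rw [zero_add] at h2
    refine h2.congr fun n => ?_
    have h3 : ∀ x, (u n - v) x + v x = u n x := fun x => by simp
    simp only [h3]
    have h4 := hg.integrable_rep hs hμ hp hps (hu n)
    have h5 := hg.integrable_rep hs hμ hp hps (hd n)
    have h6 : Integrable (fun x => g (u n x) - g ((u n - v) x)) := h4.sub h5
    rw [integral_sub h6 (hg.integrable_rep hs hμ hp hps hv), integral_sub h4 h5]
    ring
  · rw [integral_add (hd n).integrable_sq (hSob _ _ (hd n)).2.1]
    refine add_le_add ?_ ((hSob _ _ (hd n)).2.2.trans (by gcongr; exact hdn n))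
    rw [le_inv_mul_iff₀ hμ]
    exact ((hd n).integral_sq_le hμ).trans (by gcongr; exact hdn n)
  · filter_upwards [h] with x hx
    simpa using hx.sub_const (v x)

/-- Compactness, up to translations, of sequences that are almost minimizing for the limit problem
and lie below the Nehari manifold. -/
theorem exists_shift_tendsto (hf : IsNonlinearity f p) (hs : 0 < s) (hμ : 0 < μ)
    (hp : 2 < p) (hps : N * (1 / 2 - 1 / p) < s) {u : ℕ → Space N → ℝ} {a : ℕ → L2 N}
    (hu : ∀ n, Rep s μ (u n) (a n)) (ha : ∀ n, a n ≠ 0)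
    (hJ : ∀ n, ‖a n‖ ^ 2 ≤ ∫ x, f (u n x) * u n x)
    (hm : Tendsto (fun n => 1 / 4 * ‖a n‖ ^ 2 + ∫ x, excess f (u n x)) atTop
      (𝓝 (groundLevel N s f μ))) :
    ∃ y : ℕ → Space N, ∃ k : ℕ → ℕ, StrictMono k ∧ ∃ v b, Rep s μ v b ∧ b ≠ 0 ∧
      Tendsto (fun n => shift (y (k n)) (a (k n))) atTop (𝓝 b) := by
  have hG := hf.subcritical_mul_self
  have hH := hf.subcritical_excess
  have hHnn : ∀ w : Space N → ℝ, 0 ≤ ∫ x, excess f (w x) := fun w =>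
    integral_nonneg fun x => hf.excess_nonneg (w x)
  obtain ⟨C, hC⟩ : ∃ C, ∀ n, ‖a n‖ ≤ C := by
    obtain ⟨B, hB⟩ := hm.bddAbove_range
    refine ⟨Real.sqrt (4 * B), fun n => Real.le_sqrt_of_sq_le ?_⟩
    have := hB ⟨n, rfl⟩
    simp only at this
    linarith [hHnn (u n)]
  obtain ⟨c, hc, hlow⟩ := exists_le_eLpNorm hf N hs hμ hp hps
  obtain ⟨y, b, hb, k₁, hk₁, hweak₁⟩ := exists_shift_weakTendsto_ne_zero hs hμ hp hps hC hc
    fun n => hlow _ _ (hu n) (ha n) (hJ n)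
  obtain ⟨k₂, hk₂, hae⟩ := hweak₁.exists_subseq_ae_tendsto hs hμ (C := C)
    (fun n => by rw [norm_shift]; exact hC _)
  set k : ℕ → ℕ := fun n => k₁ (k₂ n) with hk
  have hkm : StrictMono k := hk₁.comp hk₂
  set a' : ℕ → L2 N := fun n => shift (y (k n)) (a (k n)) with ha'
  set u' : ℕ → Space N → ℝ := fun n x => u (k n) (x + y (k n)) with hu'
  have hrep : ∀ n, Rep s μ (u' n) (a' n) := fun n => (hu (k n)).shift hμ _
  have hweak : WeakTendsto a' b := fun c => (hweak₁ c).comp hk₂.tendsto_atTop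
  have hnorm : ∀ n, ‖a' n‖ = ‖a (k n)‖ := fun n => norm_shift _ _
  have hint : ∀ (g : ℝ → ℝ) n, ∫ x, g (u' n x) = ∫ x, g (u (k n) x) := fun g n =>
    integral_add_right_eq_self (fun x => g (u (k n) x)) (y (k n))
  have hC' : ∀ n, ‖a' n‖ ≤ C := fun n => by rw [hnorm]; exact hC _
  have hJ' : ∀ n, ‖a' n‖ ^ 2 ≤ ∫ x, f (u' n x) * u' n x := fun n => by
    rw [hnorm, hint (fun t => f t * t)]; exact hJ _
  have hm' : Tendsto (fun n => 1 / 4 * ‖a' n‖ ^ 2 + ∫ x, excess f (u' n x)) atTop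
      (𝓝 (groundLevel N s f μ)) := by
    refine (hm.comp hkm.tendsto_atTop).congr fun n => ?_
    rw [hnorm, hint (excess f)]; rfl
  obtain ⟨v, hv, hvae⟩ := Rep.of_ae_tendsto hrep hae
  have hsqd := hweak.norm_sub_sq
  have hHd := hH.tendsto_integral_rep_sub hs hμ hp.le hps hrep hv hC' hvae
  have hGd := hG.tendsto_integral_rep_sub hs hμ hp.le hps hrep hv hC' hvae
  refine ⟨y, k, hkm, v, b, hv, hb, ?_⟩
  have hΦd : Tendsto (fun n => 1 / 4 * ‖a' n - b‖ ^ 2 + ∫ x, excess f ((u' n - v) x)) atTop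
      (𝓝 (groundLevel N s f μ - (1 / 4 * ‖b‖ ^ 2 + ∫ x, excess f (v x)))) := by
    have := (hm'.add (hsqd.const_mul (1 / 4))).sub hHd
    rw [show groundLevel N s f μ + 1 / 4 * -‖b‖ ^ 2 - ∫ x, excess f (v x) =
      groundLevel N s f μ - (1 / 4 * ‖b‖ ^ 2 + ∫ x, excess f (v x)) by ring] at this
    exact this.congr fun n => by ring
  -- If `v` satisfies the constraint inequality, its share of the energy is at least the ground
  -- level. The remainder's energy then has a nonpositive limit, and both of its terms are
  -- nonnegative.
  rcases le_or_gt (‖b‖ ^ 2) (∫ x, f (v x) * v x) with hJv | hJv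
  · have hmv := groundLevel_le hf hs hμ hp hps hv hb hJv
    have hlim : Tendsto (fun n => ‖a' n - b‖ ^ 2) atTop (𝓝 0) := by
      refine tendsto_order.2 ⟨fun c hc => .of_forall fun n => hc.trans_le (sq_nonneg _),
        fun c hc => ?_⟩
      filter_upwards [hΦd.eventually_lt_const (u := c / 4) (by linarith)] with n hn
      linarith [hHnn (u' n - v)]
    rw [tendsto_iff_norm_sub_tendsto_zero]
    have := (Real.continuous_sqrt.tendsto _).comp hlim
    simpa [Function.comp_def, Real.sqrt_sq] using this
  -- Otherwise the splitting passes the inequality, strictly, to the remainder, which is therefore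
  -- nonzero and has energy at least the ground level. The limit of that energy is strictly smaller,
  -- since `b ≠ 0`.
  · exfalso
    have hev : ∀ᶠ n in atTop, ‖a' n - b‖ ^ 2 < ∫ x, f ((u' n - v) x) * (u' n - v) x := by
      have h1 := (hsqd.add hGd).eventually_lt_const (u := 0) (by linarith)
      filter_upwards [h1] with n hn
      linarith [hJ' n]
    have hge : ∀ᶠ n in atTop, groundLevel N s f μ ≤
        1 / 4 * ‖a' n - b‖ ^ 2 + ∫ x, excess f ((u' n - v) x) := by
      filter_upwards [hev] with n hn
      have hrd := (hrep n).sub hv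
      refine groundLevel_le hf hs hμ hp hps hrd (fun h0 => ?_) hn.le
      rw [h0] at hrd hn
      have h1 := hrd.integral_sq
      rw [map_zero, norm_zero, zero_pow two_ne_zero,
        integral_eq_zero_iff_of_nonneg (fun x => sq_nonneg _) hrd.integrable_sq] at h1
      have h2 : ∫ x, f ((u' n - v) x) * (u' n - v) x = 0 := by
        rw [integral_congr_ae (g := fun _ => 0), integral_zero]
        filter_upwards [h1] with x hx
        rw [pow_eq_zero_iff two_ne_zero |>.1 hx, mul_zero]
      rw [h2, norm_zero] at hn
      norm_num at hn
    have h1 := ge_of_tendsto hΦd hge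
    have h2 : 0 < ‖b‖ ^ 2 := by have := norm_pos_iff.2 hb; positivity
    linarith [hHnn v]

end FracSP

/-! ### The Nehari manifold with potential -/

namespace FracSP

variable {N : ℕ}

theorem gammaConst_pos {α : ℝ} (hα : α ∈ Set.Ioo (0 : ℝ) N) : 0 < gammaConst N α := by
  have h1 := Real.Gamma_pos_of_pos (half_pos hα.1)
  have h2 : 0 < Real.Gamma ((N : ℝ) / 2 - α / 2) := Real.Gamma_pos_of_pos (by linarith [hα.2])
  rw [gammaConst]
  positivity

/-- The Poisson interaction energy is nonnegative: test the equation with its solution. -/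
theorem integral_poisson_mul_sq_nonneg {α ε : ℝ} (hα : α ∈ Set.Ioo (0 : ℝ) N) (hε : 0 < ε)
    (θ : ℝ) (u : Space N → ℝ) : 0 ≤ ∫ x, poisson α θ ε u x * u x ^ 2 := by
  by_cases h : ∃ φ, IsPoissonSolution α θ ε u φ
  · rw [poisson, dif_pos h]
    obtain ⟨g, hg, htest⟩ := h.choose_spec
    have h1 := htest _ g hg
    rw [inner_self_eq_norm_sq_to_K] at h1
    have h2 : ‖g‖ ^ 2 = ε ^ (α - θ) * gammaConst N α * ∫ x, u x ^ 2 * h.choose x :=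
      Complex.ofReal_injective (by rw [← h1]; norm_cast)
    have h3 : 0 < ε ^ (α - θ) * gammaConst N α :=
      mul_pos (Real.rpow_pos_of_pos hε _) (gammaConst_pos hα)
    simp only [mul_comm _ (u _ ^ 2)]
    exact (mul_nonneg_iff_of_pos_left h3).1 (h2 ▸ sq_nonneg _)
  -- Without a solution `poisson` is zero by definition, so solvability of the equation plays no
  -- role.
  · rw [poisson, dif_neg h]; simp

section Nehari

variable {s α θ V₀ p ε : ℝ} {V : Space N → ℝ} {f : ℝ → ℝ} {u : Space N → ℝ} {a : L2 N}

theorem normWSq_eq (hV₀ : 0 < V₀) (hu : MemW s V ε u) (ha : Rep s V₀ u a) :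
    normWSq s V ε u = ‖a‖ ^ 2 + ∫ x, (V (ε • x) - V₀) * u x ^ 2 := by
  have h1 : ∫ x, (V (ε • x) - V₀) * u x ^ 2 =
      (∫ x, V (ε • x) * u x ^ 2) - V₀ * ∫ x, u x ^ 2 := by
    simp only [sub_mul]
    rw [integral_sub hu.2 (ha.integrable_sq.const_mul V₀), integral_const_mul]
  rw [normWSq, h1, ← ha.norm_sq hV₀]
  ring

theorem norm_sq_le_of_mem_nehariN (hV₀ : 0 < V₀) (hα : α ∈ Set.Ioo (0 : ℝ) N) (hε : 0 < ε)
    (hV : ∀ x, V₀ ≤ V x) (hu : u ∈ nehariN s α θ V f ε) (ha : Rep s V₀ u a) :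
    ‖a‖ ^ 2 ≤ ∫ x, f (u x) * u x := by
  have h1 := hu.2.2
  rw [nehariJ, normWSq_eq hV₀ hu.1 ha] at h1
  have h2 := integral_poisson_mul_sq_nonneg hα hε θ u
  have h3 : 0 ≤ ∫ x, (V (ε • x) - V₀) * u x ^ 2 :=
    integral_nonneg fun x => mul_nonneg (sub_nonneg.2 (hV _)) (sq_nonneg _)
  linarith

/-- The Poisson term has weight `1/4` in the energy and `1` in the constraint, so `I_ε - J_ε / 4`
does not contain it. -/
theorem energyI_eq_of_mem_nehariN (hf : IsNonlinearity f p) (hs : 0 < s) (hV₀ : 0 < V₀)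
    (hp : 2 ≤ p) (hps : N * (1 / 2 - 1 / p) < s) (hu : u ∈ nehariN s α θ V f ε)
    (ha : Rep s V₀ u a) :
    energyI s α θ V f ε u = 1 / 4 * ‖a‖ ^ 2 + (∫ x, excess f (u x)) +
      1 / 4 * ∫ x, (V (ε • x) - V₀) * u x ^ 2 := by
  have h1 := hu.2.2
  have h2 := normWSq_eq hV₀ hu.1 ha
  rw [nehariJ] at h1
  rw [integral_excess hf hs hV₀ hp hps ha, energyI]
  rw [h2] at h1
  rw [normWSq] at h2
  linarith

end Nehari

theorem exists_ball_integral_sq_pos {v : Space N → ℝ} (hv : Integrable (fun x => v x ^ 2))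
    (h : 0 < ∫ x, v x ^ 2) : ∃ r > 0, 0 < ∫ x in Metric.ball (0 : Space N) r, v x ^ 2 := by
  have h1 : Tendsto (fun n : ℕ => ∫ x in Metric.ball (0 : Space N) n, v x ^ 2) atTop
      (𝓝 (∫ x in ⋃ n : ℕ, Metric.ball (0 : Space N) n, v x ^ 2)) :=
    tendsto_setIntegral_of_monotone (fun _ => measurableSet_ball)
      (fun m n hmn => Metric.ball_subset_ball (by exact_mod_cast hmn)) hv.integrableOn
  rw [Metric.iUnion_ball_nat, Measure.restrict_univ] at h1
  obtain ⟨n, hn, hn0⟩ := ((h1.eventually_const_lt h).and (eventually_gt_atTop 0)).exists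
  exact ⟨n, by exact_mod_cast hn0, hn⟩

/-- Concentration of translated sequences at minimum points of the potential. -/
theorem exists_tendsto_minimum {V : Space N → ℝ} {V₀ : ℝ} (hV : Continuous V)
    (hmin : ∀ x, V₀ ≤ V x)
    (hV_inf : (V₀ : EReal) <
      liminf (fun x => (V x : EReal)) (comap (fun x : Space N => ‖x‖) atTop))
    {ε : ℕ → ℝ} (hε_pos : ∀ n, 0 < ε n) (hε : Tendsto ε atTop (𝓝 0)) {y : ℕ → Space N}
    {w : ℕ → Space N → ℝ} {v : Space N → ℝ} (hw2 : ∀ n, MemLp (w n) 2 volume)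
    (hv2 : MemLp v 2 volume) (hv0 : 0 < ∫ x, v x ^ 2)
    (hwv : Tendsto (fun n => ∫ x, (w n x - v x) ^ 2) atTop (𝓝 0))
    (hint : ∀ n, Integrable (fun x => (V (ε n • (x + y n)) - V₀) * w n x ^ 2))
    (hlim : Tendsto (fun n => ∫ x, (V (ε n • (x + y n)) - V₀) * w n x ^ 2) atTop (𝓝 0)) :
    ∃ z, V z = V₀ ∧ ∃ k : ℕ → ℕ, StrictMono k ∧
      Tendsto (fun n => ε (k n) • y (k n)) atTop (𝓝 z) := by
  obtain ⟨r, hr, hβ⟩ := exists_ball_integral_sq_pos hv2.integrable_sq hv0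
  set B := Metric.ball (0 : Space N) r
  set β := ∫ x in B, v x ^ 2 with hβdef
  -- From `v² ≤ 2w² + 2(w - v)²` and `∫ (w - v)² < β / 4`.
  have hwB : ∀ᶠ n in atTop, β / 4 ≤ ∫ x in B, w n x ^ 2 := by
    filter_upwards [hwv.eventually_lt_const (u := β / 4) (by positivity)] with n hn
    have hd : Integrable (fun x => (w n x - v x) ^ 2) := ((hw2 n).sub hv2).integrable_sq
    have h1 : β ≤ ∫ x in B, (2 * w n x ^ 2 + 2 * (w n x - v x) ^ 2) :=
      integral_mono hv2.integrable_sq.integrableOn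
        (((hw2 n).integrable_sq.const_mul 2).add (hd.const_mul 2)).integrableOn fun x => by
          simp only
          nlinarith [sq_nonneg (2 * w n x - v x)]
    rw [integral_add ((hw2 n).integrable_sq.const_mul 2).integrableOn
      (hd.const_mul 2).integrableOn, integral_const_mul, integral_const_mul] at h1
    have h2 : ∫ x in B, (w n x - v x) ^ 2 ≤ ∫ x, (w n x - v x) ^ 2 :=
      setIntegral_le_integral hd (.of_forall fun x => sq_nonneg _)
    linarith
  -- If `V ≥ V₀ + η` on the whole rescaled ball, the mass `β / 4` would keep the potential integral
  -- above `ηβ / 4`.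
  have key : ∀ η > 0, ∀ᶠ n in atTop, ∃ x, ‖x‖ < r ∧ V (ε n • (x + y n)) < V₀ + η := by
    intro η hη
    filter_upwards [hwB, hlim.eventually_lt_const (u := η * (β / 4)) (by positivity)] with n h1 h2
    by_contra! hcon
    have h3 : ∫ x in B, η * w n x ^ 2 ≤ ∫ x in B, (V (ε n • (x + y n)) - V₀) * w n x ^ 2 := by
      refine setIntegral_mono_on ((hw2 n).integrable_sq.const_mul η).integrableOn
        (hint n).integrableOn measurableSet_ball fun x hx => ?_
      have := hcon x (by simpa [B] using hx)
      gcongr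
      linarith
    have h4 : ∫ x in B, (V (ε n • (x + y n)) - V₀) * w n x ^ 2 ≤
        ∫ x, (V (ε n • (x + y n)) - V₀) * w n x ^ 2 :=
      setIntegral_le_integral (hint n) (.of_forall fun x =>
        mul_nonneg (sub_nonneg.2 (hmin _)) (sq_nonneg _))
    rw [integral_const_mul] at h3
    have h5 := mul_le_mul_of_nonneg_left h1 hη.le
    linarith
  have hεr : Tendsto (fun n => ε n * r) atTop (𝓝 0) := by simpa using hε.mul_const r
  have hnear : ∀ n (x : Space N), ‖x‖ < r → dist (ε n • (x + y n)) (ε n • y n) ≤ ε n * r := by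
    intro n x hx
    rw [dist_eq_norm, ← smul_sub, add_sub_cancel_right, norm_smul, Real.norm_of_nonneg (hε_pos n).le]
    have := (hε_pos n).le
    gcongr
  -- Outside a ball `V` exceeds a level `c > V₀`, so points where `V < c` stay bounded, and `ε n • y
  -- n` is within `ε n * r` of such points.
  obtain ⟨c, hc1, hc2⟩ := EReal.lt_iff_exists_real_btwn.1 hV_inf
  have hc := eventually_lt_of_lt_liminf hc2
  rw [eventually_comap, eventually_atTop] at hc
  obtain ⟨ρ, hρ⟩ := hc
  have hbdd : ∀ᶠ n in atTop, ε n • y n ∈ Metric.closedBall (0 : Space N) (ρ + 1) := by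
    filter_upwards [key (c - V₀) (sub_pos.2 (EReal.coe_lt_coe_iff.1 hc1)),
      hεr.eventually_lt_const zero_lt_one] with n ⟨x, hx, hVx⟩ hn
    have h1 : ‖ε n • (x + y n)‖ < ρ := by
      by_contra! hle
      have := EReal.coe_lt_coe_iff.1 (hρ _ hle _ rfl)
      linarith
    have h2 := hnear n x hx
    rw [dist_eq_norm] at h2
    rw [mem_closedBall_zero_iff]
    have h3 : ‖ε n • y n‖ ≤ ‖ε n • (x + y n)‖ + ‖ε n • (x + y n) - ε n • y n‖ := by
      rw [← norm_sub_rev]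
      simpa using norm_add_le (ε n • (x + y n)) (ε n • y n - ε n • (x + y n))
    linarith
  obtain ⟨z, -, k, hk, hz⟩ := tendsto_subseq_of_frequently_bounded
    (Metric.isBounded_closedBall (x := (0 : Space N)) (r := ρ + 1)) hbdd.frequently
  refine ⟨z, le_antisymm ?_ (hmin z), k, hk, hz⟩
  -- Near a point with `V z > V₀`, continuity keeps `V` above `V₀ + η`, against `key`.
  by_contra! hlt
  set η := (V z - V₀) / 2 with hη
  have hη0 : 0 < η := by rw [hη]; linarith
  obtain ⟨δ, hδ, hball⟩ := Metric.eventually_nhds_iff.1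
    ((hV.tendsto z).eventually_const_lt (show V₀ + η < V z by rw [hη]; linarith))
  obtain ⟨n, ⟨x, hx, hVx⟩, h1, h2⟩ := ((hk.tendsto_atTop.eventually (key η hη0)).and
    ((hz.eventually (Metric.ball_mem_nhds z (half_pos hδ))).and
      ((hεr.comp hk.tendsto_atTop).eventually_lt_const (half_pos hδ)))).exists
  have h3 := hnear (k n) x hx
  have h4 := dist_triangle (ε (k n) • (x + y (k n))) (ε (k n) • y (k n)) z
  have h5 := hball (y := ε (k n) • (x + y (k n))) (by
    simp only [Function.comp_apply] at h1 h2
    linarith)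
  linarith

end FracSP

end

/-! ### Energy squeeze, compactness and concentration combined -/

theorem proposition4p1 (N : ℕ) (s α θ : ℝ)
    (hs : s ∈ Set.Ioo (0 : ℝ) 1) (hα : α ∈ Set.Ioo (0 : ℝ) N) (hθ : θ ∈ Set.Ioo (0 : ℝ) α)
    (hN : (N : ℝ) ∈ Set.Ioo (2 * s) (2 * s + α))
    -- the potential, its minimum `V₀`, and `V₀ < liminf V` at infinity
    (V : FracSP.Space N → ℝ) (V₀ : ℝ) (hV : Continuous V)
    (hV₀ : IsLeast (Set.range V) V₀) (hV₀_pos : 0 < V₀)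
    (hV_inf : (V₀ : EReal) <
      liminf (fun x => (V x : EReal)) (comap (fun x : FracSP.Space N => ‖x‖) atTop))
    -- the nonlinearity
    (f : ℝ → ℝ) (hf_smooth : ContDiff ℝ 1 f) (hf_neg : ∀ t ≤ 0, f t = 0)
    (hf_zero : Tendsto (fun t => f t / t) (𝓝[≠] 0) (𝓝 0))
    (hf_growth : ∃ q₀ ∈ Set.Ioo (2 : ℝ) (2 * N / (N - 2 * s) - 1),
      Tendsto (fun t => f t / t ^ q₀) atTop (𝓝 0))
    (hf_AR : ∃ K > (4 : ℝ), ∀ t > 0,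
      0 < K * FracSP.primitive f t ∧ K * FracSP.primitive f t ≤ t * f t)
    (hf_mono : StrictMonoOn (fun t => f t / t ^ 3) (Set.Ioi 0))
    -- the sequences
    (ε : ℕ → ℝ) (hε_pos : ∀ n, 0 < ε n) (hε : Tendsto ε atTop (𝓝 0))
    (u : ℕ → FracSP.Space N → ℝ) (hu : ∀ n, u n ∈ FracSP.nehariN s α θ V f (ε n))
    (hI : Tendsto (fun n => FracSP.energyI s α θ V f (ε n) (u n)) atTop
      (𝓝 (FracSP.groundLevel N s f V₀))) :
    ∃ y' : ℕ → FracSP.Space N, ∃ k : ℕ → ℕ, StrictMono k ∧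
      (∃ v : FracSP.Space N → ℝ,
        FracSP.TendstoHs s (fun j => fun x => u (k j) (x + y' (k j))) v) ∧
      ∃ y : FracSP.Space N, y ∈ {x | V x = V₀} ∧
        Tendsto (fun j => ε (k j) • y' (k j)) atTop (𝓝 y) := by
  open FracSP in
  obtain ⟨q, ⟨hq2, hqN⟩, hgrowth⟩ := hf_growth
  obtain ⟨K, hK, hAR⟩ := hf_AR
  have hNs : 0 < (N : ℝ) - 2 * s := by linarith [hN.1]
  -- With `p = q + 1`, the bound `p < 2N/(N - 2s)` is this inequality rewritten.
  have hps : N * (1 / 2 - 1 / (q + 1)) < s := by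
    have h1 : (q + 1) * (N - 2 * s) < 2 * N := by
      rw [← lt_div_iff₀ hNs]; linarith
    have h2 : 0 < q + 1 := by linarith
    rw [← sub_pos, show s - N * (1 / 2 - 1 / (q + 1)) =
      (2 * N - (q + 1) * (N - 2 * s)) / (2 * (q + 1)) by field_simp; ring]
    exact div_pos (by linarith) (by linarith)
  have hp : 2 < q + 1 := by linarith
  have hK0 : 0 < K := by linarith
  have hF : ∀ t > 0, 0 < primitive f t := fun t ht => (pos_iff_pos_of_mul_pos (hAR t ht).1).1 hK0
  have hf : IsNonlinearity f (q + 1) :=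
    { continuous := hf_smooth.continuous
      eq_zero := hf_neg
      tendsto_zero := hf_zero
      tendsto_atTop := by simpa using hgrowth
      primitive_pos := hF
      primitive_le := fun t ht => by nlinarith [(hAR t ht).2, hF t ht]
      strictMono := hf_mono }
  have hmin : ∀ x, V₀ ≤ V x := fun x => hV₀.2 ⟨x, rfl⟩
  choose a ha using fun n => (hu n).1.1.exists_rep hV₀_pos
  have ha0 : ∀ n, a n ≠ 0 := fun n => (ha n).ne_zero (hu n).2.1
  have hJ := fun n => norm_sq_le_of_mem_nehariN hV₀_pos hα (hε_pos n) hmin (hu n) (ha n)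
  have hIeq := fun n => energyI_eq_of_mem_nehariN hf hs.1 hV₀_pos hp.le hps (hu n) (ha n)
  have hge := fun n => groundLevel_le hf hs.1 hV₀_pos hp hps (ha n) (ha0 n) (hJ n)
  have hDnn : ∀ n, 0 ≤ ∫ x, (V (ε n • x) - V₀) * u n x ^ 2 := fun n =>
    integral_nonneg fun x => mul_nonneg (sub_nonneg.2 (hmin _)) (sq_nonneg _)
  -- The reduced energy lies between the ground level and `I`; its convergence forces the potential
  -- term, the only difference from `I`, to vanish.
  have hΦ : Tendsto (fun n => 1 / 4 * ‖a n‖ ^ 2 + ∫ x, excess f (u n x)) atTop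
      (𝓝 (groundLevel N s f V₀)) :=
    tendsto_of_tendsto_of_tendsto_of_le_of_le tendsto_const_nhds hI hge fun n => by
      simp only [hIeq n]
      linarith [hDnn n]
  have hD : Tendsto (fun n => ∫ x, (V (ε n • x) - V₀) * u n x ^ 2) atTop (𝓝 0) := by
    have := (hI.sub hΦ).const_mul 4
    rw [sub_self, mul_zero] at this
    refine this.congr fun n => ?_
    rw [hIeq n]; ring
  obtain ⟨y, k, hk, v, b, hv, hb, hlim⟩ := exists_shift_tendsto hf hs.1 hV₀_pos hp hps ha ha0 hJ hΦ
  have hrep : ∀ n, Rep s V₀ (fun x => u (k n) (x + y (k n))) (shift (y (k n)) (a (k n))) :=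
    fun n => (ha (k n)).shift hV₀_pos _
  have hnorm : Tendsto (fun n => ‖shift (y (k n)) (a (k n)) - b‖) atTop (𝓝 0) :=
    tendsto_iff_norm_sub_tendsto_zero.1 hlim
  have hv0 : 0 < ∫ x, v x ^ 2 := by
    refine lt_of_le_of_ne (integral_nonneg fun x => sq_nonneg _) fun h0 => hb ?_
    rw [eq_comm, integral_eq_zero_iff_of_nonneg (fun x => sq_nonneg _) hv.integrable_sq] at h0
    refine hv.eq_zero_of_ae hV₀_pos ?_
    filter_upwards [h0] with x hx
    exact pow_eq_zero_iff two_ne_zero |>.1 hx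
  have hL2 : Tendsto (fun n => ∫ x, (u (k n) (x + y (k n)) - v x) ^ 2) atTop (𝓝 0) := by
    have h1 := (hnorm.pow 2).const_mul V₀⁻¹
    rw [zero_pow two_ne_zero, mul_zero] at h1
    refine squeeze_zero (fun n => integral_nonneg fun x => sq_nonneg _) (fun n => ?_) h1
    rw [le_inv_mul_iff₀ hV₀_pos]
    exact ((hrep n).sub hv).integral_sq_le hV₀_pos
  have hint : ∀ n, Integrable (fun x => (V (ε (k n) • (x + y (k n))) - V₀) *
      u (k n) (x + y (k n)) ^ 2) := by
    intro n
    refine Integrable.comp_add_right (f := fun x => (V (ε (k n) • x) - V₀) * u (k n) x ^ 2) ?_ _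
    simp only [sub_mul]
    exact (hu (k n)).1.2.sub ((ha (k n)).integrable_sq.const_mul V₀)
  have hD' : Tendsto (fun n => ∫ x, (V (ε (k n) • (x + y (k n))) - V₀) *
      u (k n) (x + y (k n)) ^ 2) atTop (𝓝 0) :=
    (hD.comp hk.tendsto_atTop).congr fun n => (integral_add_right_eq_self
      (fun x => (V (ε (k n) • x) - V₀) * u (k n) x ^ 2) (y (k n))).symm
  obtain ⟨z, hz, k', hk', hz'⟩ := exists_tendsto_minimum hV hmin hV_inf
    (fun n => hε_pos (k n)) (hε.comp hk.tendsto_atTop) (fun n => (hrep n).memLp) hv.memLp hv0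
    hL2 hint hD'
  refine ⟨y, fun n => k (k' n), hk.comp hk', ⟨v, fun n => (hrep (k' n)).memHs hV₀_pos,
    hv.memHs hV₀_pos, ?_⟩, z, hz, hz'⟩
  refine squeeze_zero (fun n => Real.sqrt_nonneg _)
    (fun n => ((hrep (k' n)).sub hv).hsNorm_le hV₀_pos) ?_
  simpa using (hnorm.comp hk'.tendsto_atTop).const_mul (Real.sqrt (1 + V₀⁻¹))
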